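/- Let $\lambda\in\mathbb C$, $a,N\in\mathbb N=\{0,1,2,\dots\}$ and $m\in\mathbb Z$ with $m>N$. For $b\in\mathbb Z$ let $\mathrm{Pol}_b[t]_{\rm even}\subset\mathbb C[t]$ be the span of the monomials $t^{b-2j}$, $0\le j\le b/2$ (so it is $\{0\}$ if $b<0$), and put $S_\ell^\mu=-\big((1+t^2)\frac{d^2}{dt^2}+(1+2\mu)t\frac{d}{dt}-\ell(\ell+2\mu)\big)$ and $\vartheta_t=t\frac{d}{dt}$. Let $\Xi(\lambda,a,N,m)$ be the complex vector space of tuples $(g_k)_{k=m-N}^{m+N}$ with $g_k\in\mathrm{Pol}_{a-k}[t]_{\rm even}$ such that the polynomials $f_j:=g_{m-j}$ $(-N\le j\le N)$ satisfy, for $0\le j\le N$, $$(A_j^{+})\quad S_{a+m-j}^{\lambda+j-1}f_{j}-2(N-j)f_{j+1}'=0,\qquad (A_j^{-})\quad S_{a-m-j}^{\lambda+j-1}f_{-j}+2(N-j)f_{-j-1}'=0,$$ and, for $1\le j\le N$, $$(B_j^+)\quad 2\big(-m(\lambda+a-1)+j(\lambda-1+\vartheta_t)\big)f_j+(N-j)f_{j+1}'+(N+j)f_{j-1}'=0,$$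 $$(B_j^-)\quad 2\big(m(\lambda+a-1)+j(\lambda-1+\vartheta_t)\big)f_{-j}-(N+j)f_{-j+1}'-(N-j)f_{-j-1}'=0$$ (terms with $f_{\pm(N+1)}$ have coefficient $0$). Let $$\Lambda(N,a)=\{N+1-a-q:\ q\in\mathbb Z,\ \max(0,N-a+m)\le q\le 2N\}.$$ Then the following are equivalent: (i) $\Xi(\lambda,a,N,m)\ne\{0\}$; (ii) $\dim_{\mathbb C}\Xi(\lambda,a,N,m)=1$; (iii) $\lambda\in\Lambda(N,a)$. Moreover, if these conditions hold then, with $\nu:=\lambda+a$ (an integer), $\Xi(\lambda,a,N,m)$ is spanned by the tuple $(g_k)$ given by $$g_k(t)=i^{k-m}(-1)^{\nu-1}\sum_{r=0}^{N-m+k}(-1)^rA(N-m+k,r)\,\widetilde C^{\lambda+N-1-r}_{a-k+2(1-N-\nu+r)}(it)\qquad(m-N\le k\le m-1),$$ $$g_k(t)=i^{m-k}\sum_{r=0}^{N+m-k}(-1)^rB(N-m+k,r)\,\widetilde C^{\lambda+N-1-r}_{a+k-2(m+N-r)}(it)\qquad(m\le k\le m+N).$$ Here $[x]$ is the integer part (floor)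 of $x$; the renormalized Gegenbauer polynomial is $$\widetilde C_\ell^\mu(z)=\sum_{k=0}^{[\ell/2]}\frac{\Gamma(\mu+\ell-k)}{\Gamma(\mu+[\frac{\ell+1}{2}])}\frac{(-1)^k}{k!\,(\ell-2k)!}(2z)^{\ell-2k}\quad(\ell\ge0),\qquad \widetilde C_\ell^\mu=0\quad(\ell<0);$$ and $$\Gamma(d,r)=\binom dr\frac{\Gamma\big(\lambda+[\frac{\nu-\lambda-|m|+N-d-1}{2}]\big)}{\Gamma\big(\lambda+[\frac{\nu-\lambda-|m|-1}{2}]\big)}\,\frac{\Gamma(2N-r+1)}{\Gamma(N+1)}\,\frac{\Gamma(N+|m|+1)}{\Gamma(N+|m|+1-r)},$$ $$A(d,r)=(-1)^{\nu-1}\,\Gamma(d,r)\,\frac{\Gamma\big(\lambda+[\frac{-\nu-\lambda-|m|+N-d+1}{2}]\big)}{\Gamma\big(\lambda+[\frac{\nu-\lambda-|m|+N-d-1}{2}]\big)}\,\frac{\Gamma(N+\nu)}{\Gamma(N+\nu-r)},$$ $$B(d,r)=(-1)^{d-N}\,\Gamma(2N-d,r)\,\frac{\Gamma(N-\nu+2)}{\Gamma(N-\nu+2-r)}.$$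 Every quotient $\Gamma(z+n)/\Gamma(z)$ with $n\in\mathbb Z$ is understood as the rational function of $z$ equal to $z(z+1)\cdots(z+n-1)$ for $n\ge0$ and to $\big((z+n)(z+n+1)\cdots(z-1)\big)^{-1}$ for $n<0$. -/

import Mathlib

open Polynomial

noncomputable section

namespace GegenbauerSystem

/-! ### Quotients of Gamma values -/

/-- The quotient `Γ(z + n) / Γ(z)` for an integer shift `n`, as a rational function of `z`:
`z (z+1) ⋯ (z+n-1)` for `n ≥ 0`, and `1 / ((z+n) (z+n+1) ⋯ (z-1))` for `n < 0`.
This is the usual meaning of such a quotient when both Gamma values are poles. -/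
def gammaShift (z : ℂ) (n : ℤ) : ℂ :=
  if 0 ≤ n then ∏ i ∈ Finset.range n.toNat, (z + i)
  else (∏ i ∈ Finset.range (-n).toNat, (z + n + i))⁻¹

/-- The quotient `Γ(x) / Γ(y)` for integers `x`, `y`, in the sense of `gammaShift`. -/
def gammaQuot (x y : ℤ) : ℂ := gammaShift (y : ℂ) (x - y)

theorem gamma_add_nat (z : ℂ) (k : ℕ) (hz : ∀ j : ℕ, z ≠ -j) :
    Complex.Gamma (z + k) = (∏ i ∈ Finset.range k, (z + i)) * Complex.Gamma z := by
  induction k with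
  | zero => simp
  | succ k ih =>
    have h : z + k ≠ 0 := fun h => hz k (eq_neg_of_add_eq_zero_left h)
    rw [Finset.prod_range_succ, Nat.cast_succ, ← add_assoc, Complex.Gamma_add_one _ h, ih]
    ring

/-- Away from the poles of the Gamma function, `gammaShift` is the quotient of Gamma values. -/
theorem gammaShift_eq (z : ℂ) (n : ℤ) (hz : ∀ j : ℕ, z ≠ -j) (hn : ∀ j : ℕ, z + n ≠ -j) :
    gammaShift z n = Complex.Gamma (z + n) / Complex.Gamma z := by
  unfold gammaShift
  split_ifs with h
  · obtain ⟨k, rfl⟩ := Int.eq_ofNat_of_zero_le h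
    rw [eq_div_iff (Complex.Gamma_ne_zero hz)]
    simpa using (gamma_add_nat z k hz).symm
  · obtain ⟨k, hk⟩ := Int.eq_ofNat_of_zero_le (show 0 ≤ -n by omega)
    have e : z = (z + n) + k := by
      have : (n : ℂ) = -((k : ℤ) : ℂ) := by rw [← hk]; push_cast; ring
      rw [this]; push_cast; ring
    have h1 := gamma_add_nat (z + n) k hn
    rw [← e] at h1
    have hp : Complex.Gamma z ≠ 0 := Complex.Gamma_ne_zero hz
    have hq : Complex.Gamma (z + n) ≠ 0 := Complex.Gamma_ne_zero hn
    rw [hk, h1]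
    simp only [Int.toNat_natCast]
    rw [h1] at hp
    have := left_ne_zero_of_mul hp
    field_simp

/-! ### Renormalized Gegenbauer polynomials -/

/-- The renormalized Gegenbauer polynomial of degree index `ℓ ∈ ℕ`,
`∑_{k ≤ ℓ/2} Γ(μ+ℓ-k)/Γ(μ+[(ℓ+1)/2]) (-1)^k / (k! (ℓ-2k)!) (2z)^(ℓ-2k)`. -/
def gegenbauerNat (μ : ℂ) (ℓ : ℕ) : ℂ[X] :=
  ∑ k ∈ Finset.range (ℓ / 2 + 1),
    C (gammaShift (μ + ((ℓ + 1) / 2 : ℕ)) ((ℓ : ℤ) - k - ((ℓ + 1) / 2 : ℕ))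
        * ((-1) ^ k / ((k.factorial : ℂ) * ((ℓ - 2 * k).factorial : ℂ))))
      * (2 * X) ^ (ℓ - 2 * k)

/-- The renormalized Gegenbauer polynomial with an integer index; it is `0` for `ℓ < 0`. -/
def gegenbauer (μ : ℂ) (ℓ : ℤ) : ℂ[X] :=
  if 0 ≤ ℓ then gegenbauerNat μ ℓ.toNat else 0

/-- The polynomial `t ↦ C̃_ℓ^μ(i t)`. -/
def gegenbauerI (μ : ℂ) (ℓ : ℤ) : ℂ[X] := (gegenbauer μ ℓ).comp (C Complex.I * X)

/-! ### The system of differential equations -/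

/-- `Pol_b[t]_even`, the span of the monomials `t^(b-2j)`, `0 ≤ j ≤ b/2`; it is `0` for `b < 0`. -/
def polEven (b : ℤ) : Submodule ℂ ℂ[X] :=
  Submodule.span ℂ {p | ∃ n j : ℕ, (n : ℤ) + 2 * j = b ∧ p = X ^ n}

/-- The imaginary Gegenbauer operator
`S_ℓ^μ = -((1+t²) d²/dt² + (1+2μ) t d/dt - ℓ(ℓ+2μ))`. -/
def gegenS (μ : ℂ) (ℓ : ℤ) (f : ℂ[X]) : ℂ[X] :=
  -((1 + X ^ 2) * derivative (derivative f) + C (1 + 2 * μ) * (X * derivative f)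
    - C ((ℓ : ℂ) * (ℓ + 2 * μ)) * f)

/-- Left-hand side of `(A_j^+)`. -/
def LAplus (lam : ℂ) (a N : ℕ) (m : ℤ) (j : ℕ) (f : ℤ → ℂ[X]) : ℂ[X] :=
  gegenS (lam + j - 1) (a + m - j) (f j)
    - C (2 * ((N : ℂ) - j)) * derivative (f (j + 1))

/-- Left-hand side of `(A_j^-)`. -/
def LAminus (lam : ℂ) (a N : ℕ) (m : ℤ) (j : ℕ) (f : ℤ → ℂ[X]) : ℂ[X] :=
  gegenS (lam + j - 1) (a - m - j) (f (-j))
    + C (2 * ((N : ℂ) - j)) * derivative (f (-j - 1))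

/-- Left-hand side of `(B_j^+)`. -/
def LBplus (lam : ℂ) (a N : ℕ) (m : ℤ) (j : ℕ) (f : ℤ → ℂ[X]) : ℂ[X] :=
  2 * (C (-(m : ℂ) * (lam + a - 1) + j * (lam - 1)) * f j + C (j : ℂ) * (X * derivative (f j)))
    + C ((N : ℂ) - j) * derivative (f (j + 1))
    + C ((N : ℂ) + j) * derivative (f (j - 1))

/-- Left-hand side of `(B_j^-)`. -/
def LBminus (lam : ℂ) (a N : ℕ) (m : ℤ) (j : ℕ) (f : ℤ → ℂ[X]) : ℂ[X] :=
  2 * (C ((m : ℂ) * (lam + a - 1) + j * (lam - 1)) * f (-j)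
      + C (j : ℂ) * (X * derivative (f (-j))))
    - C ((N : ℂ) + j) * derivative (f (-j + 1))
    - C ((N : ℂ) - j) * derivative (f (-j - 1))

/-- The reflection of `g = (g_k)`: `f_j = g_{m-j}`, so that
`(f_{-N}, …, f_N) = (g_{m+N}, …, g_{m-N})`. -/
def reflect (m : ℤ) (g : ℤ → ℂ[X]) : ℤ → ℂ[X] := fun j => g (m - j)

/-- The solution space `Ξ(λ, a, N, m)`. A tuple `(g_k)`, `m - N ≤ k ≤ m + N`, is written as a
family indexed by `ℤ` that vanishes outside this range (the entries outside the range occur in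
the equations only with the coefficient `0`). -/
def solutionSpace (lam : ℂ) (a N : ℕ) (m : ℤ) : Submodule ℂ (ℤ → ℂ[X]) where
  carrier := {g |
    (∀ k : ℤ, m - N ≤ k → k ≤ m + N → g k ∈ polEven (a - k)) ∧
    (∀ k : ℤ, ¬ (m - N ≤ k ∧ k ≤ m + N) → g k = 0) ∧
    (∀ j : ℕ, j ≤ N →
      LAplus lam a N m j (reflect m g) = 0 ∧ LAminus lam a N m j (reflect m g) = 0) ∧
    (∀ j : ℕ, 1 ≤ j → j ≤ N →
      LBplus lam a N m j (reflect m g) = 0 ∧ LBminus lam a N m j (reflect m g) = 0)}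
  zero_mem' := by
    refine ⟨fun k _ _ => Submodule.zero_mem _, fun _ _ => rfl, fun j _ => ?_, fun j _ _ => ?_⟩ <;>
      simp [LAplus, LAminus, LBplus, LBminus, reflect, gegenS]
  add_mem' := by
    rintro f g ⟨f1, f2, f3, f4⟩ ⟨g1, g2, g3, g4⟩
    refine ⟨fun k h h' => Submodule.add_mem _ (f1 k h h') (g1 k h h'),
      fun k h => by simp [f2 k h, g2 k h], fun j h => ⟨?_, ?_⟩, fun j h h' => ⟨?_, ?_⟩⟩
    · have e := congrArg₂ (· + ·) (f3 j h).1 (g3 j h).1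
      simp only [LAplus, reflect, gegenS, Pi.add_apply, derivative_add] at e ⊢
      linear_combination e
    · have e := congrArg₂ (· + ·) (f3 j h).2 (g3 j h).2
      simp only [LAminus, reflect, gegenS, Pi.add_apply, derivative_add] at e ⊢
      linear_combination e
    · have e := congrArg₂ (· + ·) (f4 j h h').1 (g4 j h h').1
      simp only [LBplus, reflect, Pi.add_apply, derivative_add] at e ⊢
      linear_combination e
    · have e := congrArg₂ (· + ·) (f4 j h h').2 (g4 j h h').2
      simp only [LBminus, reflect, Pi.add_apply, derivative_add] at e ⊢
      linear_combination e
  smul_mem' := by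
    rintro c f ⟨f1, f2, f3, f4⟩
    refine ⟨fun k h h' => Submodule.smul_mem _ c (f1 k h h'),
      fun k h => by simp [f2 k h], fun j h => ⟨?_, ?_⟩, fun j h h' => ⟨?_, ?_⟩⟩
    · have e := congrArg (C c * ·) (f3 j h).1
      simp only [LAplus, reflect, gegenS, Pi.smul_apply, smul_eq_C_mul, derivative_C_mul] at e ⊢
      linear_combination e
    · have e := congrArg (C c * ·) (f3 j h).2
      simp only [LAminus, reflect, gegenS, Pi.smul_apply, smul_eq_C_mul, derivative_C_mul] at e ⊢
      linear_combination e
    · have e := congrArg (C c * ·) (f4 j h h').1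
      simp only [LBplus, reflect, Pi.smul_apply, smul_eq_C_mul, derivative_C_mul] at e ⊢
      linear_combination e
    · have e := congrArg (C c * ·) (f4 j h h').2
      simp only [LBminus, reflect, Pi.smul_apply, smul_eq_C_mul, derivative_C_mul] at e ⊢
      linear_combination e

/-- The set `Λ(N, a) = {N+1-a-q : max(0, N-a+m) ≤ q ≤ 2N}` (it also depends on `m`). -/
def Lambda (a N : ℕ) (m : ℤ) : Set ℤ :=
  {l | ∃ q : ℤ, max 0 ((N : ℤ) - a + m) ≤ q ∧ q ≤ 2 * N ∧ l = N + 1 - a - q}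

/-! ### The explicit solution, for integers `l` (the parameter `λ`) and `ν = λ + a`.
Integer division by `2` below is the floor `[·/2]`. -/

/-- The constant `Γ(d, r)`. -/
def constG (l ν : ℤ) (N : ℕ) (m : ℤ) (d r : ℕ) : ℂ :=
  (d.choose r : ℂ)
    * gammaQuot (l + (ν - l - |m| + N - d - 1) / 2) (l + (ν - l - |m| - 1) / 2)
    * gammaQuot (2 * N - r + 1) (N + 1)
    * gammaQuot (N + |m| + 1) (N + |m| + 1 - r)

/-- The constant `A(d, r)`. -/
def constA (l ν : ℤ) (N : ℕ) (m : ℤ) (d r : ℕ) : ℂ :=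
  (-1) ^ (ν - 1) * constG l ν N m d r
    * gammaQuot (l + (-ν - l - |m| + N - d + 1) / 2) (l + (ν - l - |m| + N - d - 1) / 2)
    * gammaQuot (N + ν) (N + ν - r)

/-- The constant `B(d, r)`, for `d ≤ 2N`. -/
def constB (l ν : ℤ) (N : ℕ) (m : ℤ) (d r : ℕ) : ℂ :=
  (-1) ^ ((d : ℤ) - N) * constG l ν N m (2 * N - d) r
    * gammaQuot (N - ν + 2) (N - ν + 2 - r)

/-- The polynomials `g_k` of the explicit solution, with `ν = l + a`: one formula for
`m - N ≤ k ≤ m - 1`, another for `m ≤ k ≤ m + N`, and `0` outside the range of indices. -/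
def explicitSolution (l : ℤ) (a N : ℕ) (m : ℤ) : ℤ → ℂ[X] := fun k =>
  if m - N ≤ k ∧ k ≤ m - 1 then
    C (Complex.I ^ (k - m) * (-1) ^ (l + a - 1)) *
      ∑ r ∈ Finset.range ((N - m + k).toNat + 1),
        C ((-1) ^ r * constA l (l + a) N m (N - m + k).toNat r)
          * gegenbauerI ((l : ℂ) + N - 1 - r) (a - k + 2 * (1 - N - (l + a) + r))
  else if m ≤ k ∧ k ≤ m + N then
    C (Complex.I ^ (m - k)) *
      ∑ r ∈ Finset.range ((N + m - k).toNat + 1),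
        C ((-1) ^ r * constB l (l + a) N m (N - m + k).toNat r)
          * gegenbauerI ((l : ℂ) + N - 1 - r) (a + k - 2 * (m + N - r))
  else 0

end GegenbauerSystem

end

/-! Put σ = λ + a - 1, and let e(j, p) be the coefficient of t^(a-m+j-2p) in f_j times the factorial
of that degree. Derivatives become shifts, and the system turns into two recursions for -N ≤ j ≤ N,
`RecLower` and `RecThree` (`rec_of_mem`, `mem_of_rec`).

Uniqueness (`eq_zero_of_rec`). At p = 0, `RecThree` reads 2(j-m)(σ+j) e(j,0) + (N-j) e(j+1,0) = 0,
and m > N gives j ≠ m. Descending from j = N, the row p = 0 vanishes unless it meets the index j =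
-σ. Each later row is determined by the previous one: through `RecLower` if σ ≠ m + p, and through
`RecThree` if σ = m + p, because its coefficient of e(j,p) is then 2(j+m)(j-m-p) ≠ 0. Hence e(-σ, 0)
determines the solution. A nonzero solution needs -N ≤ -σ ≤ N and a nonnegative degree a - m - σ;
this is the condition λ ∈ Λ(N, a).

Existence. With s = N + σ and α = N + m, the explicit tuple has, up to one common factor, the
coefficients (-1)^(j+p) 2^(j-2p) S / (α+p-s)!, where S is the terminating sum `sumLower` with M = N
+ j. The two recursions become the contiguous relations `sumLowerInt_rec` and `sumLowerInt_three`.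
The formula for k ≥ m produces `sumLower` directly; the one for k < m produces `sumUpper`, and the
hypergeometric transformation `sumLower_mul_finv_eq`, grown from the Vandermonde convolution, shows
that they are one closed form. The coefficient at (-σ, 0) is nonzero, so the tuple spans. -/

open Polynomial

noncomputable section

namespace GegenbauerSystem

/-! ### Weighted coefficients -/

/-- The `n`-th coefficient multiplied by `n!`; it is `0` for `n < 0`. -/
def wcoeff (f : ℂ[X]) (n : ℤ) : ℂ :=
  if 0 ≤ n then (n.toNat.factorial : ℂ) * f.coeff n.toNat else 0

theorem wcoeff_natCast (f : ℂ[X]) (k : ℕ) : wcoeff f k = (k.factorial : ℂ) * f.coeff k := by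
  simp [wcoeff]

@[simp] theorem wcoeff_zero (n : ℤ) : wcoeff 0 n = 0 := by simp [wcoeff]

theorem wcoeff_add (f g : ℂ[X]) (n : ℤ) : wcoeff (f + g) n = wcoeff f n + wcoeff g n := by
  unfold wcoeff; split_ifs <;> simp [mul_add]

theorem wcoeff_sub (f g : ℂ[X]) (n : ℤ) : wcoeff (f - g) n = wcoeff f n - wcoeff g n := by
  unfold wcoeff; split_ifs <;> simp [mul_sub]

theorem wcoeff_neg (f : ℂ[X]) (n : ℤ) : wcoeff (-f) n = -wcoeff f n := by
  unfold wcoeff; split_ifs <;> simp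

theorem wcoeff_C_mul (c : ℂ) (f : ℂ[X]) (n : ℤ) : wcoeff (C c * f) n = c * wcoeff f n := by
  unfold wcoeff; split_ifs <;> simp [mul_left_comm]

theorem wcoeff_two_mul (f : ℂ[X]) (n : ℤ) : wcoeff (2 * f) n = 2 * wcoeff f n := by
  rw [two_mul, wcoeff_add, two_mul]

theorem wcoeff_sum {ι : Type*} (s : Finset ι) (f : ι → ℂ[X]) (n : ℤ) :
    wcoeff (∑ i ∈ s, f i) n = ∑ i ∈ s, wcoeff (f i) n := by
  unfold wcoeff; split_ifs <;> simp [Finset.mul_sum]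

/-- The bound on `n` matters: at `n = -1` the left side is `0`, while the right side is the constant
term of `f`. -/
theorem wcoeff_derivative (f : ℂ[X]) {n : ℤ} (hn : 0 ≤ n) :
    wcoeff (derivative f) n = wcoeff f (n + 1) := by
  obtain ⟨k, rfl⟩ := Int.eq_ofNat_of_zero_le hn
  rw [show ((k : ℤ) + 1) = ((k + 1 : ℕ) : ℤ) by simp, wcoeff_natCast, wcoeff_natCast,
    coeff_derivative, Nat.factorial_succ]
  push_cast; ring

theorem wcoeff_X_mul_derivative (f : ℂ[X]) (n : ℤ) :
    wcoeff (X * derivative f) n = n * wcoeff f n := by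
  by_cases hn : 0 ≤ n
  · obtain ⟨k, rfl⟩ := Int.eq_ofNat_of_zero_le hn
    rw [wcoeff_natCast, wcoeff_natCast]
    cases k with
    | zero => simp
    | succ k => rw [coeff_X_mul, coeff_derivative]; push_cast; ring
  · simp [wcoeff, hn]

theorem wcoeff_gegenS (μ : ℂ) (ℓ : ℤ) (f : ℂ[X]) {n : ℤ} (hn : 0 ≤ n) :
    wcoeff (gegenS μ ℓ f) n
      = -wcoeff f (n + 2) + (ℓ - n) * (ℓ + n + 2 * μ) * wcoeff f n := by
  -- In terms of the Euler operator ϑ, which is diagonal on coefficients, t² d²/dt² = ϑ² - ϑ.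
  have h : gegenS μ ℓ f = -(derivative (derivative f)
      + (X * derivative (X * derivative f) - X * derivative f)
      + C (1 + 2 * μ) * (X * derivative f) - C ((ℓ : ℂ) * (ℓ + 2 * μ)) * f) := by
    unfold gegenS
    rw [derivative_mul, derivative_X]
    ring
  rw [h, wcoeff_neg, wcoeff_sub, wcoeff_add, wcoeff_add, wcoeff_sub, wcoeff_C_mul, wcoeff_C_mul,
    wcoeff_X_mul_derivative, wcoeff_X_mul_derivative, wcoeff_derivative _ hn,
    wcoeff_derivative _ (by omega), add_assoc n 1 1]
  norm_num
  ring

theorem eq_zero_of_wcoeff {f : ℂ[X]} (h : ∀ n : ℤ, 0 ≤ n → wcoeff f n = 0) : f = 0 := by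
  ext k
  have := h k (by simp)
  rw [wcoeff_natCast] at this
  simpa [Nat.factorial_ne_zero] using this

theorem mem_polEven_iff {b : ℤ} {f : ℂ[X]} :
    f ∈ polEven b ↔ ∀ n : ℕ, f.coeff n ≠ 0 → ∃ j : ℕ, (n : ℤ) + 2 * j = b := by
  constructor
  · intro hf
    unfold polEven at hf
    induction hf using Submodule.span_induction with
    | mem x hx =>
      obtain ⟨k, j, h, rfl⟩ := hx
      intro n hn
      rw [coeff_X_pow] at hn
      have : n = k := by by_contra h'; simp [h'] at hn
      exact ⟨j, this ▸ h⟩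
    | zero => simp
    | add x y _ _ hx hy =>
      intro n hn
      by_cases h : x.coeff n = 0
      · exact hy n (by simpa [h] using hn)
      · exact hx n h
    | smul c x _ hx =>
      intro n hn
      refine hx n fun h => hn ?_
      simp [h]
  · intro h
    rw [f.as_sum_support]
    refine Submodule.sum_mem _ fun n hn => ?_
    obtain ⟨j, hj⟩ := h n (mem_support_iff.1 hn)
    rw [← C_mul_X_pow_eq_monomial, ← smul_eq_C_mul]
    exact Submodule.smul_mem _ _ (Submodule.subset_span ⟨n, j, hj, rfl⟩)

theorem wcoeff_eq_zero_of_lt {b n : ℤ} {f : ℂ[X]} (hf : f ∈ polEven b) (h : b < n) :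
    wcoeff f n = 0 := by
  by_cases hn : 0 ≤ n
  · obtain ⟨k, rfl⟩ := Int.eq_ofNat_of_zero_le hn
    rw [wcoeff_natCast]
    by_contra h'
    obtain ⟨j, hj⟩ := mem_polEven_iff.1 hf k (right_ne_zero_of_mul h')
    omega
  · simp [wcoeff, hn]

theorem wcoeff_eq_zero_of_odd {b n : ℤ} {f : ℂ[X]} (hf : f ∈ polEven b) (h : (b - n) % 2 = 1) :
    wcoeff f n = 0 := by
  by_cases hn : 0 ≤ n
  · obtain ⟨k, rfl⟩ := Int.eq_ofNat_of_zero_le hn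
    rw [wcoeff_natCast]
    by_contra h'
    obtain ⟨j, hj⟩ := mem_polEven_iff.1 hf k (right_ne_zero_of_mul h')
    omega
  · simp [wcoeff, hn]

/-! ### The system in terms of coefficients -/

theorem wcoeff_LAplus (lam : ℂ) (a N : ℕ) (m : ℤ) (j : ℕ) (f : ℤ → ℂ[X]) {n : ℤ} (hn : 0 ≤ n) :
    wcoeff (LAplus lam a N m j f) n
      = -wcoeff (f j) (n + 2) + (a + m - j - n) * (a + m + j + n + 2 * lam - 2) * wcoeff (f j) n
        - 2 * (N - j) * wcoeff (f (j + 1)) (n + 1) := by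
  rw [LAplus, wcoeff_sub, wcoeff_C_mul, wcoeff_gegenS _ _ _ hn, wcoeff_derivative _ hn]
  push_cast; ring

theorem wcoeff_LAminus (lam : ℂ) (a N : ℕ) (m : ℤ) (j : ℕ) (f : ℤ → ℂ[X]) {n : ℤ} (hn : 0 ≤ n) :
    wcoeff (LAminus lam a N m j f) n
      = -wcoeff (f (-j)) (n + 2)
        + (a - m - j - n) * (a - m + j + n + 2 * lam - 2) * wcoeff (f (-j)) n
        + 2 * (N - j) * wcoeff (f (-j - 1)) (n + 1) := by
  rw [LAminus, wcoeff_add, wcoeff_C_mul, wcoeff_gegenS _ _ _ hn, wcoeff_derivative _ hn]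
  push_cast; ring

theorem wcoeff_LBplus (lam : ℂ) (a N : ℕ) (m : ℤ) (j : ℕ) (f : ℤ → ℂ[X]) {n : ℤ} (hn : 0 ≤ n) :
    wcoeff (LBplus lam a N m j f) n
      = 2 * (-m * (lam + a - 1) + j * (lam - 1 + n)) * wcoeff (f j) n
        + (N - j) * wcoeff (f (j + 1)) (n + 1) + (N + j) * wcoeff (f (j - 1)) (n + 1) := by
  simp only [LBplus, wcoeff_add, wcoeff_two_mul, wcoeff_C_mul, wcoeff_X_mul_derivative,
    wcoeff_derivative _ hn]
  ring

theorem wcoeff_LBminus (lam : ℂ) (a N : ℕ) (m : ℤ) (j : ℕ) (f : ℤ → ℂ[X]) {n : ℤ} (hn : 0 ≤ n) :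
    wcoeff (LBminus lam a N m j f) n
      = 2 * (m * (lam + a - 1) + j * (lam - 1 + n)) * wcoeff (f (-j)) n
        - (N + j) * wcoeff (f (-j + 1)) (n + 1) - (N - j) * wcoeff (f (-j - 1)) (n + 1) := by
  simp only [LBminus, wcoeff_sub, wcoeff_add, wcoeff_two_mul, wcoeff_C_mul,
    wcoeff_X_mul_derivative, wcoeff_derivative _ hn]
  ring

/-- The recursion for weighted coefficients that lowers `j`, with `σ = λ + a - 1`. -/
def RecLower (σ : ℂ) (N : ℕ) (m : ℤ) (e : ℤ → ℤ → ℂ) (j p : ℤ) : Prop :=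
  4 * p * (σ - m - p) * e j p = e j (p - 1) - 2 * (N + j) * e (j - 1) (p - 1)

/-- The recursion for weighted coefficients with three neighbouring values of `j`. -/
def RecThree (σ : ℂ) (N : ℕ) (m : ℤ) (e : ℤ → ℤ → ℂ) (j p : ℤ) : Prop :=
  2 * (-m * σ + j * (σ - m + j - 2 * p)) * e j p + (N - j) * e (j + 1) p
    + (N + j) * e (j - 1) (p - 1) = 0

/-- The weighted coefficients of a tuple `g`, arranged by `j` and the distance `2p` from the
maximal degree. -/
def topCoeff (a : ℕ) (m : ℤ) (g : ℤ → ℂ[X]) (j p : ℤ) : ℂ :=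
  wcoeff (g (m - j)) (a - m + j - 2 * p)

theorem mem_polEven_of_range {a N : ℕ} {m : ℤ} {g : ℤ → ℂ[X]}
    (h1 : ∀ k : ℤ, m - N ≤ k → k ≤ m + N → g k ∈ polEven (a - k))
    (h2 : ∀ k : ℤ, ¬ (m - N ≤ k ∧ k ≤ m + N) → g k = 0) (j : ℤ) :
    g (m - j) ∈ polEven (a - m + j) := by
  by_cases h : m - N ≤ m - j ∧ m - j ≤ m + N
  · simpa [sub_add] using h1 (m - j) h.1 h.2
  · rw [h2 _ h]; exact Submodule.zero_mem _

theorem topCoeff_eq_zero {a N : ℕ} {m : ℤ} {g : ℤ → ℂ[X]}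
    (h1 : ∀ k : ℤ, m - N ≤ k → k ≤ m + N → g k ∈ polEven (a - k))
    (h2 : ∀ k : ℤ, ¬ (m - N ≤ k ∧ k ≤ m + N) → g k = 0) (j : ℤ) {p : ℤ} (hp : p < 0) :
    topCoeff a m g j p = 0 :=
  wcoeff_eq_zero_of_lt (mem_polEven_of_range h1 h2 j) (by omega)

theorem rec_of_mem {lam : ℂ} {a N : ℕ} {m : ℤ} {g : ℤ → ℂ[X]}
    (hg : g ∈ solutionSpace lam a N m) {j : ℤ} (hj : -(N : ℤ) ≤ j) (hj' : j ≤ N)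
    {p : ℤ} (hp : 2 * p ≤ a - m + j) :
    RecLower (lam + a - 1) N m (topCoeff a m g) j p ∧
      RecThree (lam + a - 1) N m (topCoeff a m g) j p := by
  obtain ⟨-, -, h3, h4⟩ := hg
  have hn : 0 ≤ (a : ℤ) - m + j - 2 * p := by omega
  have key : ∀ i q : ℤ, topCoeff a m g i q = wcoeff (reflect m g i) (a - m + i - 2 * q) :=
    fun _ _ => rfl
  unfold RecLower RecThree
  rcases le_total 0 j with h | h
  · obtain ⟨i, rfl⟩ := Int.eq_ofNat_of_zero_le h
    have A := congrArg (wcoeff · ((a : ℤ) - m + i - 2 * p)) (h3 i (by omega)).1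
    simp only [wcoeff_LAplus _ _ _ _ _ _ hn, wcoeff_zero] at A
    have e1 : topCoeff a m g i (p - 1) = wcoeff (reflect m g i) (a - m + i - 2 * p + 2) := by
      rw [key]; ring_nf
    have e2 : topCoeff a m g (i + 1) p
        = wcoeff (reflect m g (i + 1)) (a - m + i - 2 * p + 1) := by
      rw [key]; ring_nf
    have e3 : topCoeff a m g (i - 1) (p - 1)
        = wcoeff (reflect m g (i - 1)) (a - m + i - 2 * p + 1) := by
      rw [key]; ring_nf
    rw [e1, e2, e3, key]
    have B : 2 * (-m * (lam + a - 1) + i * ((lam + a - 1) - m + i - 2 * p))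
          * wcoeff (reflect m g i) (a - m + i - 2 * p)
        + (N - i) * wcoeff (reflect m g (i + 1)) (a - m + i - 2 * p + 1)
        + (N + i) * wcoeff (reflect m g (i - 1)) (a - m + i - 2 * p + 1) = 0 := by
      rcases Nat.eq_zero_or_pos i with rfl | hi
      · have A' := congrArg (wcoeff · ((a : ℤ) - m + (0 : ℕ) - 2 * p)) (h3 0 (by omega)).2
        simp only [wcoeff_LAminus _ _ _ _ _ _ hn, wcoeff_zero] at A'
        push_cast at A A' ⊢
        simp only [neg_zero, add_zero] at A A' ⊢
        linear_combination (-1/2) * A + (1/2) * A'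
      · have B := congrArg (wcoeff · ((a : ℤ) - m + i - 2 * p)) (h4 i hi (by omega)).1
        simp only [wcoeff_LBplus _ _ _ _ _ _ hn, wcoeff_zero] at B
        push_cast at B ⊢
        linear_combination B
    push_cast at A B ⊢
    -- For j ≥ 0 the sum (A⁺) + 2(B⁺) eliminates f_{j+1} and takes the form that (A⁻) already has
    -- for j ≤ 0.
    exact ⟨by linear_combination A + 2 * B, B⟩
  · obtain ⟨i, hi⟩ := Int.eq_ofNat_of_zero_le (show 0 ≤ -j by omega)
    obtain rfl : j = -i := by omega
    have A := congrArg (wcoeff · ((a : ℤ) - m + -i - 2 * p)) (h3 i (by omega)).2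
    simp only [wcoeff_LAminus _ _ _ _ _ _ hn, wcoeff_zero] at A
    have e1 : topCoeff a m g (-i) (p - 1)
        = wcoeff (reflect m g (-i)) (a - m + -i - 2 * p + 2) := by
      rw [key]; ring_nf
    have e2 : topCoeff a m g (-i + 1) p
        = wcoeff (reflect m g (-i + 1)) (a - m + -i - 2 * p + 1) := by
      rw [key]; ring_nf
    have e3 : topCoeff a m g (-i - 1) (p - 1)
        = wcoeff (reflect m g (-i - 1)) (a - m + -i - 2 * p + 1) := by
      rw [key]; ring_nf
    rw [e1, e2, e3, key]
    push_cast at A ⊢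
    refine ⟨by linear_combination A, ?_⟩
    rcases Nat.eq_zero_or_pos i with rfl | hi
    · have A' := congrArg (wcoeff · ((a : ℤ) - m + -(0 : ℕ) - 2 * p)) (h3 0 (by omega)).1
      simp only [wcoeff_LAplus _ _ _ _ _ _ hn, wcoeff_zero] at A'
      push_cast at A' A ⊢
      simp only [neg_zero, add_zero, sub_zero] at A A' ⊢
      linear_combination (-1/2) * A' + (1/2) * A
    · have B := congrArg (wcoeff · ((a : ℤ) - m + -i - 2 * p)) (h4 i hi (by omega)).2
      simp only [wcoeff_LBminus _ _ _ _ _ _ hn, wcoeff_zero] at B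
      push_cast at B ⊢
      linear_combination -B

theorem mem_of_rec {lam : ℂ} {a N : ℕ} {m : ℤ} {g : ℤ → ℂ[X]}
    (h1 : ∀ k : ℤ, m - N ≤ k → k ≤ m + N → g k ∈ polEven (a - k))
    (h2 : ∀ k : ℤ, ¬ (m - N ≤ k ∧ k ≤ m + N) → g k = 0)
    (h : ∀ j p : ℤ, -(N : ℤ) ≤ j → j ≤ N → 2 * p ≤ a - m + j →
      RecLower (lam + a - 1) N m (topCoeff a m g) j p ∧
        RecThree (lam + a - 1) N m (topCoeff a m g) j p) :
    g ∈ solutionSpace lam a N m := by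
  have hpol : ∀ i : ℤ, reflect m g i ∈ polEven (a - m + i) := mem_polEven_of_range h1 h2
  -- In degrees of the wrong parity every term of every equation vanishes, so only the degrees a - m
  -- + j - 2p remain.
  have odd : ∀ i i' n c : ℤ, ((a : ℤ) - m + i - n) % 2 = 1 → (i' - i - c) % 2 = 0 →
      wcoeff (reflect m g i') (n + c) = 0 := fun i i' n c hc hi =>
    wcoeff_eq_zero_of_odd (hpol i') (by omega)
  have odd0 : ∀ i n : ℤ, ((a : ℤ) - m + i - n) % 2 = 1 →
      wcoeff (reflect m g i) n = 0 := fun i n hc => wcoeff_eq_zero_of_odd (hpol i) hc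
  have key : ∀ j p : ℤ, -(N : ℤ) ≤ j → j ≤ N → 2 * p ≤ a - m + j →
      (4 * p * (lam + a - 1 - m - p) * wcoeff (reflect m g j) (a - m + j - 2 * p)
        = wcoeff (reflect m g j) (a - m + j - 2 * p + 2)
          - 2 * (N + j) * wcoeff (reflect m g (j - 1)) (a - m + j - 2 * p + 1)) ∧
      2 * (-m * (lam + a - 1) + j * (lam + a - 1 - m + j - 2 * p))
          * wcoeff (reflect m g j) (a - m + j - 2 * p)
        + (N - j) * wcoeff (reflect m g (j + 1)) (a - m + j - 2 * p + 1)
        + (N + j) * wcoeff (reflect m g (j - 1)) (a - m + j - 2 * p + 1) = 0 := by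
    intro j p hj hj' hp
    obtain ⟨H1, H2⟩ := h j p hj hj' hp
    unfold RecLower topCoeff at H1
    unfold RecThree topCoeff at H2
    rw [show (a : ℤ) - m + j - 2 * (p - 1) = a - m + j - 2 * p + 2 by ring,
      show (a : ℤ) - m + (j - 1) - 2 * (p - 1) = a - m + j - 2 * p + 1 by ring] at H1
    rw [show (a : ℤ) - m + (j - 1) - 2 * (p - 1) = a - m + j - 2 * p + 1 by ring,
      show (a : ℤ) - m + (j + 1) - 2 * p = a - m + j - 2 * p + 1 by ring] at H2
    exact ⟨H1, H2⟩
  refine ⟨h1, h2, fun j hj => ⟨?_, ?_⟩, fun j hj1 hj => ⟨?_, ?_⟩⟩ <;>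
    refine eq_zero_of_wcoeff fun n hn => ?_
  · rw [wcoeff_LAplus _ _ _ _ _ _ hn]
    rcases Int.emod_two_eq_zero_or_one ((a : ℤ) - m + j - n) with hc | hc
    · obtain ⟨p, rfl⟩ : ∃ p, n = a - m + j - 2 * p := ⟨((a : ℤ) - m + j - n) / 2, by omega⟩
      obtain ⟨H1, H2⟩ := key j p (by omega) (by omega) (by omega)
      push_cast at H1 H2 ⊢
      linear_combination H1 - 2 * H2
    · rw [odd0 _ _ hc, odd j _ _ _ hc (by omega), odd j _ _ _ hc (by omega)]; simp
  · rw [wcoeff_LAminus _ _ _ _ _ _ hn]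
    rcases Int.emod_two_eq_zero_or_one ((a : ℤ) - m + -j - n) with hc | hc
    · obtain ⟨p, rfl⟩ : ∃ p, n = a - m + -j - 2 * p := ⟨((a : ℤ) - m + -j - n) / 2, by omega⟩
      obtain ⟨H1, H2⟩ := key (-j) p (by omega) (by omega) (by omega)
      push_cast at H1 H2 ⊢
      linear_combination H1
    · rw [odd0 _ _ hc, odd (-j) _ _ _ hc (by omega), odd (-j) _ _ _ hc (by omega)]; simp
  · rw [wcoeff_LBplus _ _ _ _ _ _ hn]
    rcases Int.emod_two_eq_zero_or_one ((a : ℤ) - m + j - n) with hc | hc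
    · obtain ⟨p, rfl⟩ : ∃ p, n = a - m + j - 2 * p := ⟨((a : ℤ) - m + j - n) / 2, by omega⟩
      obtain ⟨H1, H2⟩ := key j p (by omega) (by omega) (by omega)
      push_cast at H1 H2 ⊢
      linear_combination H2
    · rw [odd0 _ _ hc, odd j _ _ _ hc (by omega), odd j _ _ _ hc (by omega)]; simp
  · rw [wcoeff_LBminus _ _ _ _ _ _ hn]
    rcases Int.emod_two_eq_zero_or_one ((a : ℤ) - m + -j - n) with hc | hc
    · obtain ⟨p, rfl⟩ : ∃ p, n = a - m + -j - 2 * p := ⟨((a : ℤ) - m + -j - n) / 2, by omega⟩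
      obtain ⟨H1, H2⟩ := key (-j) p (by omega) (by omega) (by omega)
      push_cast at H1 H2 ⊢
      linear_combination -H2
    · rw [odd0 _ _ hc, odd (-j) _ _ _ hc (by omega), odd (-j) _ _ _ hc (by omega)]; simp

/-! ### Uniqueness -/

/-- Descending induction on `j ≤ N`. -/
theorem descend {N : ℕ} {P : ℤ → Prop} (hN : ∀ j : ℤ, j ≤ N → ((j < N → P (j + 1)) → P j))
    {j : ℤ} (hj : j ≤ N) : P j := by
  obtain ⟨k, hk⟩ := Int.eq_ofNat_of_zero_le (show 0 ≤ (N : ℤ) - j by omega)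
  induction k generalizing j with
  | zero => exact hN j hj fun h => by omega
  | succ k ih => exact hN j hj fun h => ih (by omega) (by push_cast at hk; omega)

/-- The region 2p ≤ D + j is stable under the steps used: (j+1, p), (j, p-1) and (j-1, p-1) stay
inside it. The factors N - j and N + j remove neighbours beyond j = N and j = -N. Only an index with
σ + j = 0 in the row p = 0 escapes, and `h0` covers it. -/
theorem eq_zero_of_rec {σ : ℂ} {N : ℕ} {m D : ℤ} (hm : (N : ℤ) < m) {e : ℤ → ℤ → ℂ}
    (he : ∀ j p : ℤ, p < 0 → e j p = 0)
    (h : ∀ j p : ℤ, -(N : ℤ) ≤ j → j ≤ N → 2 * p ≤ D + j →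
      RecLower σ N m e j p ∧ RecThree σ N m e j p)
    (h0 : ∀ j : ℤ, -(N : ℤ) ≤ j → j ≤ N → 0 ≤ D + j → σ + j = 0 → e j 0 = 0) (p : ℕ) :
    ∀ j : ℤ, -(N : ℤ) ≤ j → j ≤ N → 2 * (p : ℤ) ≤ D + j → e j p = 0 := by
  induction p with
  | zero =>
    intro j hj hj'
    refine descend (P := fun j => -(N : ℤ) ≤ j → 2 * ((0 : ℕ) : ℤ) ≤ D + j → e j (0 : ℕ) = 0)
      (fun j hj' ih hj hd => ?_) hj' hj
    push_cast at ih hd ⊢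
    by_cases hs : σ + j = 0
    · exact h0 j hj hj' (by omega) hs
    have H := (h j 0 hj hj' (by omega)).2
    unfold RecThree at H
    have h1 : ((N : ℂ) - j) * e (j + 1) 0 = 0 := by
      rcases eq_or_lt_of_le hj' with rfl | hlt
      · simp
      · rw [ih hlt (by omega) (by omega), mul_zero]
    rw [he (j - 1) (0 - 1) (by omega), h1] at H
    have hjm : ((j : ℂ) - m) ≠ 0 := by
      rw [← Int.cast_sub, Int.cast_ne_zero]; omega
    have : 2 * ((j : ℂ) - m) * (σ + j) * e j 0 = 0 := by
      push_cast at H; linear_combination H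
    simpa [hjm, hs] using this
  | succ p ih =>
    have ih' : ∀ j : ℤ, -(N : ℤ) ≤ j → j ≤ N → 2 * ((p : ℤ) + 1) ≤ D + j →
        ((N : ℂ) + j) * e (j - 1) p = 0 := by
      intro j hj hj' hd
      rcases eq_or_lt_of_le hj with rfl | hlt
      · simp
      · rw [ih (j - 1) (by omega) (by omega) (by omega), mul_zero]
    push_cast
    -- `RecLower` degenerates exactly when σ = m + p + 1 (the new row is p + 1). `RecThree` then has
    -- the coefficient 2(j+m)(j-m-(p+1)), nonzero since |j| ≤ N < m.
    by_cases hs : σ - m - ((p + 1 : ℕ) : ℂ) = 0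
    · intro j hj hj'
      refine descend (P := fun j => -(N : ℤ) ≤ j → 2 * ((p : ℤ) + 1) ≤ D + j → e j (p + 1) = 0)
        (fun j hj' ih2 hj hd => ?_) hj' hj
      have H := (h j (p + 1) hj hj' hd).2
      unfold RecThree at H
      have h1 : ((N : ℂ) - j) * e (j + 1) (p + 1) = 0 := by
        rcases eq_or_lt_of_le hj' with rfl | hlt
        · simp
        · rw [ih2 hlt (by omega) (by omega), mul_zero]
      rw [add_sub_cancel_right, h1, ih' j hj hj' hd] at H
      have hjm : ((j : ℂ) + m) ≠ 0 := by
        rw [← Int.cast_add, Int.cast_ne_zero]; omega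
      have hjp : ((j : ℂ) - m - (p + 1)) ≠ 0 := by
        have : (((j - m - (p + 1) : ℤ)) : ℂ) ≠ 0 := by rw [Int.cast_ne_zero]; omega
        simpa using this
      have : 2 * ((j : ℂ) + m) * ((j : ℂ) - m - (p + 1)) * e j (p + 1) = 0 := by
        push_cast at H hs
        linear_combination H - 2 * (-m + j) * e j (p + 1) * hs
      simpa [hjm, hjp] using this
    · intro j hj hj' hd
      have H := (h j (p + 1) hj hj' hd).1
      unfold RecLower at H
      rw [add_sub_cancel_right, ih j hj hj' (by omega)] at H
      have h2 := ih' j hj hj' hd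
      have : 4 * ((p + 1 : ℕ) : ℂ) * (σ - m - ((p + 1 : ℕ) : ℂ)) * e j (p + 1) = 0 := by
        push_cast at H ⊢
        linear_combination H - 2 * h2
      have hp1 : ((p + 1 : ℕ) : ℂ) ≠ 0 := Nat.cast_ne_zero.2 (by omega)
      simpa [hs, hp1, -Nat.cast_add] using this

/-- A solution is determined by its top coefficient at the index `j = -σ`. -/
theorem eq_zero_of_topCoeff {lam : ℂ} {a N : ℕ} {m : ℤ} (hm : (N : ℤ) < m) {g : ℤ → ℂ[X]}
    (hg : g ∈ solutionSpace lam a N m)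
    (h0 : ∀ j : ℤ, -(N : ℤ) ≤ j → j ≤ N → 0 ≤ (a : ℤ) - m + j → lam + a - 1 + j = 0 →
      topCoeff a m g j 0 = 0) : g = 0 := by
  have h1 := hg.1
  have h2 := hg.2.1
  have key := eq_zero_of_rec hm (fun j p hp => topCoeff_eq_zero h1 h2 j hp)
    (fun j p hj hj' hp => rec_of_mem hg hj hj' hp) h0
  funext k
  by_cases hk : m - N ≤ k ∧ k ≤ m + N
  · have hpol := h1 k hk.1 hk.2
    refine eq_zero_of_wcoeff fun n hn => ?_
    by_cases hlt : (a : ℤ) - k < n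
    · exact wcoeff_eq_zero_of_lt hpol hlt
    rcases Int.emod_two_eq_zero_or_one ((a : ℤ) - k - n) with hc | hc
    · have := key (((a : ℤ) - k - n) / 2).toNat (m - k) (by omega) (by omega) (by omega)
      unfold topCoeff at this
      rwa [sub_sub_cancel, show (a : ℤ) - m + (m - k)
        - 2 * ((((a : ℤ) - k - n) / 2).toNat : ℤ) = n by omega] at this
    · exact wcoeff_eq_zero_of_odd hpol hc
  · exact h2 k hk

/-! ### Reciprocal factorials and terminating sums -/

/-- The reciprocal factorial `1 / k!`; it is `0` for `k < 0`. -/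
def finv (k : ℤ) : ℂ := if 0 ≤ k then ((k.toNat.factorial : ℂ))⁻¹ else 0

theorem finv_natCast (k : ℕ) : finv k = (k.factorial : ℂ)⁻¹ := by simp [finv]

theorem finv_of_neg {k : ℤ} (hk : k < 0) : finv k = 0 := by simp [finv, hk]

theorem finv_ne_zero {k : ℤ} (hk : 0 ≤ k) : finv k ≠ 0 := by
  simp [finv, hk, Nat.factorial_ne_zero]

theorem mul_finv (k : ℤ) : (k : ℂ) * finv k = finv (k - 1) := by
  rcases lt_trichotomy k 0 with h | rfl | h
  · rw [finv_of_neg h, finv_of_neg (by omega), mul_zero]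
  · simp [finv]
  · obtain ⟨n, hn⟩ := Int.eq_ofNat_of_zero_le (show 0 ≤ k - 1 by omega)
    obtain rfl : k = (n + 1 : ℕ) := by push_cast; omega
    rw [hn, finv_natCast, finv_natCast, Nat.factorial_succ]
    have : ((n + 1 : ℕ) : ℂ) ≠ 0 := Nat.cast_ne_zero.2 (by omega)
    have := Nat.factorial_ne_zero n
    push_cast at *
    field_simp

theorem cast_descFactorial_succ (x M : ℕ) :
    ((x.descFactorial (M + 1) : ℕ) : ℂ) = (x - M) * x.descFactorial M := by
  rw [Nat.descFactorial_succ, Nat.cast_mul]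
  rcases le_total M x with h | h
  · rw [Nat.cast_sub h]
  · rcases eq_or_lt_of_le h with rfl | h
    · simp
    · simp [Nat.descFactorial_of_lt h]

/-- The sum `∑ᵣ C(M,r) (n-r)! α^{\underline r} β^{\underline r} / (p+r-M)!`. -/
def sumLower (n α β M : ℕ) (p : ℤ) : ℂ :=
  ∑ r ∈ Finset.range (M + 1), (M.choose r : ℂ) * (n - r).factorial * α.descFactorial r
    * β.descFactorial r * finv (p + r - M)

/-- The sum `∑ᵣ C(Q,r) (n-r)! α^{\underline r} s^{\underline r} / (p+r-s)!`. -/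
def sumUpper (n α s Q : ℕ) (p : ℤ) : ℂ :=
  ∑ r ∈ Finset.range (Q + 1), (Q.choose r : ℂ) * (n - r).factorial * α.descFactorial r
    * s.descFactorial r * finv (p + r - s)

theorem sumLower_of_neg (n α β M : ℕ) {p : ℤ} (hp : p < 0) : sumLower n α β M p = 0 := by
  refine Finset.sum_eq_zero fun r hr => ?_
  rw [finv_of_neg (by have := Finset.mem_range.1 hr; omega), mul_zero]

theorem sumLower_zero_left (n α β : ℕ) (p : ℤ) :
    sumLower n α β 0 p = n.factorial * finv p := by
  simp [sumLower]

theorem sumLower_zero_right (n α β M : ℕ) :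
    sumLower n α β M 0 = (n - M).factorial * α.descFactorial M * β.descFactorial M := by
  unfold sumLower
  rw [Finset.sum_eq_single_of_mem M (by simp)]
  · simp [finv]
  · intro r hr hne
    rw [finv_of_neg (by have := Finset.mem_range.1 hr; omega), mul_zero]

/-- Split p = (p+r-M-1) + (M+1-r) termwise: the first summand lowers the argument of the reciprocal
factorial, the second turns C(M+1,r) into (M+1) C(M,r). `sumUpper_rec` rests on the same splitting.
-/
theorem sumLower_rec (n α β M : ℕ) (p : ℤ) :
    p * sumLower n α β (M + 1) p
      = sumLower n α β (M + 1) (p - 1) + (M + 1) * sumLower n α β M (p - 1) := by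
  have hlast : ∀ q : ℤ, (M + 1 : ℂ) * sumLower n α β M q
      = ∑ r ∈ Finset.range (M + 1 + 1), ((M : ℂ) + 1 - r) * ((M + 1).choose r : ℂ)
        * (n - r).factorial * α.descFactorial r * β.descFactorial r * finv (q + r - M) := by
    intro q
    rw [Finset.sum_range_succ _ (M + 1)]
    unfold sumLower
    rw [Finset.mul_sum]
    push_cast
    rw [sub_self]
    simp only [zero_mul, add_zero]
    refine Finset.sum_congr rfl fun r hr => ?_
    have hr' : r ≤ M := by have := Finset.mem_range.1 hr; omega
    have h := congrArg (Nat.cast (R := ℂ)) (Nat.choose_mul_succ_eq M r)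
    rw [Nat.cast_mul, Nat.cast_mul, Nat.cast_sub (by omega)] at h
    push_cast at h
    linear_combination ((n - r).factorial : ℂ) * α.descFactorial r * β.descFactorial r
      * finv (q + r - M) * h
  rw [hlast]
  unfold sumLower
  rw [Finset.mul_sum, ← Finset.sum_add_distrib]
  refine Finset.sum_congr rfl fun r _ => ?_
  have h := mul_finv (p + r - (M + 1 : ℕ))
  rw [show p + r - ((M + 1 : ℕ) : ℤ) - 1 = p - 1 + r - ((M + 1 : ℕ) : ℤ) by ring] at h
  rw [show p - 1 + r - (M : ℤ) = p + r - ((M + 1 : ℕ) : ℤ) by push_cast; ring, ← h]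
  push_cast
  ring

theorem sumUpper_rec (n α s Q : ℕ) (p : ℤ) :
    (p + (Q + 1) - s) * sumUpper n α s (Q + 1) p
      = sumUpper n α s (Q + 1) (p - 1) + (Q + 1) * sumUpper n α s Q p := by
  have hlast : (Q + 1 : ℂ) * sumUpper n α s Q p
      = ∑ r ∈ Finset.range (Q + 1 + 1), ((Q : ℂ) + 1 - r) * ((Q + 1).choose r : ℂ)
        * (n - r).factorial * α.descFactorial r * s.descFactorial r * finv (p + r - s) := by
    rw [Finset.sum_range_succ _ (Q + 1)]
    unfold sumUpper
    rw [Finset.mul_sum]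
    push_cast
    rw [sub_self]
    simp only [zero_mul, add_zero]
    refine Finset.sum_congr rfl fun r hr => ?_
    have hr' : r ≤ Q := by have := Finset.mem_range.1 hr; omega
    have h := congrArg (Nat.cast (R := ℂ)) (Nat.choose_mul_succ_eq Q r)
    rw [Nat.cast_mul, Nat.cast_mul, Nat.cast_sub (by omega)] at h
    push_cast at h
    linear_combination ((n - r).factorial : ℂ) * α.descFactorial r * s.descFactorial r
      * finv (p + r - s) * h
  rw [hlast]
  unfold sumUpper
  rw [Finset.mul_sum, ← Finset.sum_add_distrib]
  refine Finset.sum_congr rfl fun r _ => ?_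
  have h := mul_finv (p + r - s)
  rw [show p + r - (s : ℤ) - 1 = p - 1 + r - (s : ℤ) by ring] at h
  rw [← h]
  push_cast
  ring

/-- `sumLower`, extended by `0` to negative `M`. -/
def sumLowerInt (n α β : ℕ) (M p : ℤ) : ℂ := if 0 ≤ M then sumLower n α β M.toNat p else 0

theorem sumLowerInt_natCast (n α β M : ℕ) (p : ℤ) :
    sumLowerInt n α β M p = sumLower n α β M p := by simp [sumLowerInt]

theorem sumLowerInt_of_neg (n α β : ℕ) {M : ℤ} (hM : M < 0) (p : ℤ) :
    sumLowerInt n α β M p = 0 := by simp [sumLowerInt, hM]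

theorem sumLowerInt_of_neg_right (n α β : ℕ) (M : ℤ) {p : ℤ} (hp : p < 0) :
    sumLowerInt n α β M p = 0 := by
  unfold sumLowerInt
  split_ifs
  · exact sumLower_of_neg _ _ _ _ hp
  · rfl

theorem sumLowerInt_rec (n α β : ℕ) (M p : ℤ) :
    p * sumLowerInt n α β M p
      = sumLowerInt n α β M (p - 1) + M * sumLowerInt n α β (M - 1) (p - 1) := by
  rcases lt_trichotomy M 0 with h | rfl | h
  · simp [sumLowerInt_of_neg n α β h, sumLowerInt_of_neg n α β (show M - 1 < 0 by omega)]
  · have := sumLowerInt_natCast n α β 0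
    simp only [Nat.cast_zero] at this
    rw [this, this, sumLower_zero_left, sumLower_zero_left, ← mul_finv p]
    push_cast
    ring
  · obtain ⟨k, hk⟩ := Int.eq_ofNat_of_zero_le (show 0 ≤ M - 1 by omega)
    obtain rfl : M = (k + 1 : ℕ) := by push_cast; omega
    rw [hk, sumLowerInt_natCast, sumLowerInt_natCast, sumLowerInt_natCast, sumLower_rec]
    push_cast; ring

/-- Induction on p: after multiplication by p, `sumLowerInt_rec` moves the terms to p - 1, where
they regroup into the relation for M plus M times the relation for M - 1. At p = 0 each sum has a
single term, and the claim is the recursion of falling factorials. -/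
theorem sumLowerInt_three (n α s : ℕ) (hs : s ≤ n) (p : ℤ) {M : ℤ} (h0 : 0 ≤ M) (hn : M ≤ n) :
    (((M : ℂ) - α) * (M + s - n) - p * (2 * M - n)) * sumLowerInt n α (n - s) M p
      - (n - M) * sumLowerInt n α (n - s) (M + 1) p
      + M * (α + p - s) * sumLowerInt n α (n - s) (M - 1) (p - 1) = 0 := by
  by_cases hp : p < 0
  · rw [sumLowerInt_of_neg_right _ _ _ _ hp, sumLowerInt_of_neg_right _ _ _ _ hp,
      sumLowerInt_of_neg_right _ _ _ _ (by omega)]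
    simp
  obtain ⟨k, rfl⟩ := Int.eq_ofNat_of_zero_le (not_lt.1 hp)
  clear hp
  induction k generalizing M with
  | zero =>
    obtain ⟨M, rfl⟩ := Int.eq_ofNat_of_zero_le h0
    rw [sumLowerInt_of_neg_right n α (n - s) _ (show ((0 : ℕ) : ℤ) - 1 < 0 by simp),
      show (M : ℤ) + 1 = (M + 1 : ℕ) by simp, sumLowerInt_natCast, sumLowerInt_natCast,
      Nat.cast_zero, sumLower_zero_right, sumLower_zero_right]
    have fac : ((n : ℂ) - M) * ((n - (M + 1)).factorial : ℕ)
        = if M = n then 0 else ((n - M).factorial : ℂ) := by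
      split_ifs with h
      · simp [h]
      · have : n - M = n - (M + 1) + 1 := by omega
        rw [this, Nat.factorial_succ, ← this, Nat.cast_mul, Nat.cast_sub (by omega)]
    rw [cast_descFactorial_succ, cast_descFactorial_succ, Nat.cast_sub hs]
    by_cases h : M = n
    -- At M = n the factor n - M kills the neighbour. What remains vanishes because s = 0, or
    -- because the falling factorial of n - s of length n is zero.
    · subst h
      rcases Nat.eq_zero_or_pos s with rfl | hs0
      · simp
      · simp [Nat.descFactorial_of_lt (show M - s < M by omega)]
    · rw [if_neg h] at fac
      push_cast at fac ⊢
      linear_combination (-(α - M) * α.descFactorial M * ((n - s - M) * (n - s).descFactorial M) : ℂ)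
        * fac
  | succ k ih =>
    have h1 := sumLowerInt_rec n α (n - s) M (k + 1)
    have h2 := sumLowerInt_rec n α (n - s) (M + 1) (k + 1)
    have h3 := ih h0 hn
    have h4 := sumLowerInt_rec n α (n - s) (M - 1) k
    -- The factor M makes this trivial at M = 0, where the induction hypothesis does not reach M -
    -- 1.
    have h5 : (M : ℂ) * ((((M - 1 : ℤ) : ℂ) - α) * ((M - 1 : ℤ) + s - n)
          - (k : ℤ) * (2 * (M - 1 : ℤ) - n)) * sumLowerInt n α (n - s) (M - 1) k
        - M * (n - (M - 1 : ℤ)) * sumLowerInt n α (n - s) M k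
        + M * (M - 1 : ℤ) * (α + (k : ℤ) - s)
          * sumLowerInt n α (n - s) (M - 1 - 1) (k - 1) = 0 := by
      rcases eq_or_lt_of_le h0 with rfl | hpos
      · simp
      · have := ih (M := M - 1) (by omega) (by omega)
        rw [sub_add_cancel] at this
        linear_combination (M : ℂ) * this
    have hk : ((k + 1 : ℕ) : ℂ) ≠ 0 := Nat.cast_ne_zero.2 (by omega)
    rw [← mul_right_inj' hk, mul_zero]
    push_cast at h1 h2 h3 h4 h5 ⊢
    rw [add_sub_cancel_right] at h1 h2 ⊢
    rw [add_sub_cancel_right] at h2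
    linear_combination (((M : ℂ) - α) * (M + s - n) - (k + 1) * (2 * M - n)) * h1
      - (n - M) * h2 + h3 + M * (α + k - s) * h4 + h5

theorem choose_eq_finv (x t : ℕ) :
    (x.choose t : ℂ) = x.factorial * finv t * finv (x - t) := by
  rcases le_or_gt t x with h | h
  · rw [← Nat.cast_sub h, finv_natCast, finv_natCast, Nat.cast_choose ℂ h]
    field_simp
  · rw [Nat.choose_eq_zero_of_lt h, finv_of_neg (show (x : ℤ) - t < 0 by omega)]; simp

theorem factorial_mul_finv (x : ℕ) : (x.factorial : ℂ) * finv x = 1 := by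
  rw [finv_natCast, mul_inv_cancel₀ (Nat.cast_ne_zero.2 (Nat.factorial_ne_zero x))]

/-- For p ≥ 0 the sum is n! s! / p! times Σ C(α,r) C(p,s-r) = C(α+p,s). Terms with r > s vanish
through the falling factorial of s. -/
theorem sumUpper_vandermonde (n α s : ℕ) (hs : s ≤ n) (p : ℤ) :
    sumUpper n α s n p * finv (α + p) = n.factorial * finv p * finv (α + p - s) := by
  by_cases hp : p < 0
  · rw [finv_of_neg hp, mul_zero, zero_mul]
    refine mul_eq_zero_of_left (Finset.sum_eq_zero fun r _ => ?_) _
    rcases le_or_gt r s with h | h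
    · rw [finv_of_neg (by omega), mul_zero]
    · rw [Nat.descFactorial_of_lt h]; simp
  obtain ⟨k, rfl⟩ := Int.eq_ofNat_of_zero_le (not_lt.1 hp)
  have hsum : sumUpper n α s n k
      = n.factorial * s.factorial * finv k * ((α + k).choose s : ℕ) := by
    rw [Nat.add_choose_eq, Finset.Nat.sum_antidiagonal_eq_sum_range_succ_mk, Nat.cast_sum,
      Finset.mul_sum]
    unfold sumUpper
    rw [← Finset.sum_subset (Finset.range_subset_range.2 (show s + 1 ≤ n + 1 by omega))]
    · refine Finset.sum_congr rfl fun r hr => ?_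
      have hr' : r ≤ s := by have := Finset.mem_range.1 hr; omega
      rw [Nat.descFactorial_eq_factorial_mul_choose α, Nat.descFactorial_eq_factorial_mul_choose s,
        Nat.cast_mul, Nat.cast_mul, Nat.cast_mul, choose_eq_finv n r, choose_eq_finv s r,
        choose_eq_finv k (s - r), ← Nat.cast_sub hr', ← Nat.cast_sub (hr'.trans hs),
        Nat.cast_sub hr', show (k : ℤ) - ((s : ℤ) - r) = k + r - s by ring]
      have e1 := factorial_mul_finv r
      have e2 := factorial_mul_finv (n - r)
      have e3 := factorial_mul_finv k
      generalize finv ((n - r : ℕ) : ℤ) = x1 at *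
      generalize finv (r : ℤ) = x2 at *
      generalize finv (k : ℤ) = x3 at *
      generalize finv ((k : ℤ) + r - s) = x4 at *
      generalize finv ((s : ℤ) - r) = x5 at *
      generalize ((n - r).factorial : ℂ) = y1 at *
      generalize (r.factorial : ℂ) = y2 at *
      generalize (k.factorial : ℂ) = y3 at *
      calc _ = n.factorial * (y2 * x2) * (y2 * x2) * (y1 * x1) * α.choose r * s.factorial
              * x5 * x4 := by ring
        _ = n.factorial * s.factorial * (y3 * x3) * (α.choose r * (x5 * x4)) := by
          rw [e1, e2, e3]; ring
        _ = _ := by ring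
    · intro r _ hr
      rw [Nat.descFactorial_of_lt (by have := mt Finset.mem_range.2 hr; omega : s < r)]
      simp
  rw [hsum, choose_eq_finv]
  have e1 := factorial_mul_finv s
  have e2 := factorial_mul_finv (α + k)
  push_cast at e2 ⊢
  calc _ = n.factorial * (s.factorial * finv s) * finv k
        * ((α + k).factorial * finv (α + k)) * finv (α + k - s) := by ring
    _ = _ := by rw [e1, e2]; ring

/-- A transformation of terminating hypergeometric sums, by induction on M. The case M = 0 is
Vandermonde; in the step, the three-term relation in M on the left is matched with `sumUpper_rec` on
the right. -/
theorem sumLower_mul_finv_eq (n α s M : ℕ) (hs : s ≤ n) (hM : M ≤ n) (p : ℤ) :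
    sumLower n α (n - s) M p * finv (α + p - s)
      = sumUpper n α s (n - M) p * finv (α + p - M) := by
  induction M generalizing p with
  | zero =>
    rw [sumLower_zero_left]
    simpa using (sumUpper_vandermonde n α s hs p).symm
  | succ M ih =>
    have hnM : ((n : ℂ) - M) ≠ 0 := by
      rw [sub_ne_zero, Ne, Nat.cast_inj]; omega
    have h1 := ih (by omega) p
    have h2 := ih (by omega) (p - 1)
    have hU := sumUpper_rec n α s (n - (M + 1)) p
    rw [show n - (M + 1) + 1 = n - M by omega, Nat.cast_sub hM] at hU
    have h3 := sumLowerInt_three n α s hs p (M := M) (by omega) (by omega)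
    have h4 := sumLowerInt_rec n α (n - s) M p
    rw [show (M : ℤ) + 1 = (M + 1 : ℕ) by simp, sumLowerInt_natCast, sumLowerInt_natCast] at h3
    rw [sumLowerInt_natCast, sumLowerInt_natCast] at h4
    have f1 := mul_finv (α + p - s)
    have f2 := mul_finv (α + p - M)
    rw [show (α : ℤ) + (p - 1) - s = α + p - s - 1 by ring,
      show (α : ℤ) + (p - 1) - M = α + p - M - 1 by ring] at h2
    rw [← mul_right_inj' hnM, show (α : ℤ) + p - (M + 1 : ℕ) = α + p - M - 1 by push_cast; ring]
    rw [← f1, ← f2] at h2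
    rw [← f2]
    push_cast at hU h2 h3 h4 ⊢
    linear_combination (-finv (α + p - s)) * h3 - (α + p - s) * finv (α + p - s) * h4
      + (α + p - M) * (p + n - s - M) * h1 - h2 + (α + p - M) * finv (α + p - M) * hU

/-! ### Values of quotients of Gamma values at integers -/

/-- The residue of `Γ` at the pole `x ≤ 0`. -/
def gammaResidue (x : ℤ) : ℂ := (-1) ^ x * finv (-x)

theorem gammaResidue_ne_zero {x : ℤ} (hx : x ≤ 0) : gammaResidue x ≠ 0 :=
  mul_ne_zero (zpow_ne_zero _ (by norm_num)) (finv_ne_zero (by omega))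

theorem gammaResidue_add_one (x : ℤ) : gammaResidue (x + 1) = x * gammaResidue x := by
  unfold gammaResidue
  have h := mul_finv (-x)
  rw [zpow_add_one₀ (by norm_num), show -(x + 1) = -x - 1 by ring, ← h]
  push_cast; ring

theorem gammaResidue_mul_prod (y : ℤ) (k : ℕ) :
    gammaResidue y * ∏ i ∈ Finset.range k, ((y : ℂ) + i) = gammaResidue (y + k) := by
  induction k with
  | zero => simp
  | succ k ih =>
    rw [Finset.prod_range_succ, ← mul_assoc, ih, Nat.cast_succ, ← add_assoc, gammaResidue_add_one]
    push_cast; ring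

/-- At poles the regularized quotient is a quotient of residues. For x > 0 both sides are zero: the
product runs through 0, and `gammaResidue x` vanishes. -/
theorem gammaQuot_of_nonpos_right {x y : ℤ} (hy : y ≤ 0) :
    gammaQuot x y = gammaResidue x / gammaResidue y := by
  rw [eq_div_iff (gammaResidue_ne_zero hy)]
  unfold gammaQuot gammaShift
  split_ifs with h
  · obtain ⟨k, hk⟩ := Int.eq_ofNat_of_zero_le h
    rw [hk, mul_comm, Int.toNat_natCast, gammaResidue_mul_prod, ← hk]
    congr 1; ring
  · obtain ⟨k, hk⟩ := Int.eq_ofNat_of_zero_le (show 0 ≤ -(x - y) by omega)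
    have h1 := gammaResidue_mul_prod x k
    rw [← hk, show x + -(x - y) = y by ring] at h1
    have h2 : ∏ i ∈ Finset.range k, ((x : ℂ) + i) ≠ 0 :=
      right_ne_zero_of_mul (h1 ▸ gammaResidue_ne_zero hy)
    rw [hk, Int.toNat_natCast, ← h1]
    simp only [Int.cast_sub, add_sub_cancel]
    field_simp

theorem gammaQuot_natCast_add_one (x y : ℕ) :
    gammaQuot (x + 1) (y + 1) = (x.factorial : ℂ) / y.factorial := by
  have key : ∀ z k : ℕ, (z.factorial : ℂ) * ∏ i ∈ Finset.range k, ((z : ℂ) + 1 + i)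
      = (z + k).factorial := by
    intro z k
    induction k with
    | zero => simp
    | succ k ih =>
      rw [Finset.prod_range_succ, ← mul_assoc, ih, ← add_assoc, Nat.factorial_succ]
      push_cast; ring
  have hf : ∀ z : ℕ, (z.factorial : ℂ) ≠ 0 := fun z => Nat.cast_ne_zero.2 z.factorial_ne_zero
  rw [eq_div_iff (hf y)]
  unfold gammaQuot gammaShift
  split_ifs with h
  · obtain ⟨k, rfl⟩ : ∃ k, x = y + k := ⟨x - y, by omega⟩
    have := key y k
    rw [show (((y + k : ℕ) : ℤ) + 1 - (y + 1)).toNat = k by omega, mul_comm, ← this]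
    push_cast; rfl
  · obtain ⟨k, rfl⟩ : ∃ k, y = x + k := ⟨y - x, by omega⟩
    have h1 := key x k
    have h2 : ∏ i ∈ Finset.range k, ((x : ℂ) + 1 + i) ≠ 0 :=
      right_ne_zero_of_mul (h1 ▸ hf (x + k))
    rw [show (-((x : ℤ) + 1 - ((x + k : ℕ) + 1))).toNat = k by omega, ← h1]
    rw [show ∏ i ∈ Finset.range k, (((((x + k : ℕ) : ℤ) + 1 : ℤ) : ℂ)
        + (((x : ℤ) + 1 - ((x + k : ℕ) + 1) : ℤ) : ℂ) + i)
        = ∏ i ∈ Finset.range k, ((x : ℂ) + 1 + i) from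
      Finset.prod_congr rfl fun i _ => by push_cast; ring]
    field_simp

theorem gammaQuot_descFactorial (x r : ℕ) :
    gammaQuot (x + 1) (x + 1 - r) = (x.descFactorial r : ℂ) := by
  unfold gammaQuot gammaShift
  rw [if_pos (by omega), show ((x : ℤ) + 1 - (x + 1 - r)).toNat = r by omega]
  induction r with
  | zero => simp
  | succ r ih =>
    rw [Finset.prod_range_succ', cast_descFactorial_succ, ← ih, mul_comm]
    push_cast
    congr 1
    · ring
    · exact Finset.prod_congr rfl fun i _ => by ring

/-! ### Coefficients of Gegenbauer polynomials -/

theorem gegenbauerI_natCast_coeff (μ : ℂ) (L n : ℕ) :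
    (gegenbauerI μ L).coeff n = ∑ k ∈ Finset.range (L / 2 + 1),
      gammaShift (μ + ((L + 1) / 2 : ℕ)) ((L : ℤ) - k - ((L + 1) / 2 : ℕ))
        * ((-1) ^ k / ((k.factorial : ℂ) * ((L - 2 * k).factorial : ℂ)))
        * (if n = L - 2 * k then (2 * Complex.I) ^ n else 0) := by
  simp only [gegenbauerI, gegenbauer, gegenbauerNat, Nat.cast_nonneg, if_true, Int.toNat_natCast]
  rw [← coe_compRingHom_apply, map_sum, finsetSum_coeff]
  refine Finset.sum_congr rfl fun k _ => ?_
  rw [coe_compRingHom_apply, mul_comp, C_comp, coeff_C_mul, pow_comp, mul_comp, X_comp,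
    ofNat_comp, show ((OfNat.ofNat 2 : ℕ) : ℂ[X]) * (C Complex.I * X) = C (2 * Complex.I) * X by
      rw [C_mul, mul_assoc]; rfl, mul_pow, ← C_pow, coeff_C_mul_X_pow]
  split_ifs with h
  · rw [h]
  · rfl

theorem gegenbauerI_of_neg (μ : ℂ) {ℓ : ℤ} (h : ℓ < 0) : gegenbauerI μ ℓ = 0 := by
  simp [gegenbauerI, gegenbauer, not_le.2 h]

theorem gegenbauerI_mem_polEven (μ : ℂ) {ℓ b : ℤ} (k : ℕ) (h : ℓ + 2 * k = b) :
    gegenbauerI μ ℓ ∈ polEven b := by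
  rcases lt_or_ge ℓ 0 with hl | hl
  · rw [gegenbauerI_of_neg μ hl]; exact Submodule.zero_mem _
  obtain ⟨L, rfl⟩ := Int.eq_ofNat_of_zero_le hl
  rw [mem_polEven_iff]
  intro n hn
  rw [gegenbauerI_natCast_coeff] at hn
  obtain ⟨i, hi, hne⟩ := Finset.exists_ne_zero_of_sum_ne_zero hn
  have hi' := Finset.mem_range.1 hi
  have hni : n = L - 2 * i := by
    by_contra h'
    simp [h'] at hne
  exact ⟨i + k, by push_cast; omega⟩

/-- A negative `k` is allowed: the degree `n` then exceeds `ℓ`, and `finv k` is zero. Sums over `r`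
therefore need no truncation. -/
theorem wcoeff_gegenbauerI (w ℓ n k : ℤ) (hn : 0 ≤ n) (h : ℓ = n + 2 * k) :
    wcoeff (gegenbauerI w ℓ) n = gammaQuot (w + ℓ - k) (w + (ℓ + 1) / 2)
      * ((-1) ^ k * finv k * (2 * Complex.I) ^ n) := by
  rcases lt_or_ge k 0 with hk | hk
  · rw [finv_of_neg hk, wcoeff_eq_zero_of_lt (gegenbauerI_mem_polEven _ 0 rfl) (by omega)]
    simp
  obtain ⟨n, rfl⟩ := Int.eq_ofNat_of_zero_le hn
  obtain ⟨k, rfl⟩ := Int.eq_ofNat_of_zero_le hk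
  obtain rfl : ℓ = (n + 2 * k : ℕ) := by push_cast; exact h
  rw [wcoeff_natCast, gegenbauerI_natCast_coeff, Finset.sum_eq_single_of_mem k
    (Finset.mem_range.2 (by omega))]
  · rw [if_pos (by omega), finv_natCast, Nat.add_sub_cancel]
    have hf := Nat.factorial_ne_zero n
    have e : gammaQuot (w + (n + 2 * k : ℕ) - k) (w + ((n + 2 * k : ℕ) + 1) / 2)
        = gammaShift (w + ((n + 2 * k + 1) / 2 : ℕ))
          (((n + 2 * k : ℕ) : ℤ) - k - ((n + 2 * k + 1) / 2 : ℕ)) := by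
      unfold gammaQuot
      congr 1
      · push_cast; rfl
      · push_cast; ring
    rw [e, zpow_natCast, zpow_natCast]
    field_simp
  · intro i hi hne
    have := Finset.mem_range.1 hi
    rw [if_neg (by omega), mul_zero]

/-! ### The explicit solution -/

theorem I_zpow_congr {x y : ℤ} (h : (x - y) % 4 = 0) : Complex.I ^ x = Complex.I ^ y := by
  obtain ⟨k, hk⟩ : ∃ k, x = y + 4 * k := ⟨(x - y) / 4, by omega⟩
  rw [hk, zpow_add₀ Complex.I_ne_zero, zpow_mul]
  have : Complex.I ^ (4 : ℤ) = 1 := by exact_mod_cast Complex.I_pow_four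
  rw [this, one_zpow, mul_one]

theorem neg_one_zpow_eq_I_zpow (x : ℤ) : (-1 : ℂ) ^ x = Complex.I ^ (2 * x) := by
  rw [zpow_mul]
  have : Complex.I ^ (2 : ℤ) = -1 := by exact_mod_cast Complex.I_sq
  rw [this]

theorem constG_eq {l m : ℤ} {a N d r α : ℕ} (hα : (α : ℤ) = N + m) (hm : 0 ≤ m)
    (hr : r ≤ 2 * N) (hz : l + (a - m - 1) / 2 ≤ 0) :
    constG l (l + a) N m d r = (d.choose r : ℂ)
      * (gammaResidue (l + (a - m + N - d - 1) / 2) / gammaResidue (l + (a - m - 1) / 2))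
      * ((2 * N - r).factorial / N.factorial) * α.descFactorial r := by
  unfold constG
  rw [abs_of_nonneg hm, add_sub_cancel_left, gammaQuot_of_nonpos_right hz, ← hα,
    gammaQuot_descFactorial, show (2 : ℤ) * N - r + 1 = (2 * N - r : ℕ) + 1 by omega,
    gammaQuot_natCast_add_one]

/-- The common factor of the coefficients of the explicit solution. -/
def explicitFactor (l : ℤ) (a N : ℕ) (m : ℤ) : ℂ :=
  Complex.I ^ ((a : ℤ) - m) * 2 ^ ((a : ℤ) - m) * (-1) ^ (l + a - 1 + N + m)
    / (gammaResidue (l + (a - m - 1) / 2) * N.factorial)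

/-- The Gamma quotient inside Γ(d, r) has as numerator the normalizing denominator of the Gegenbauer
polynomial. Their residues, `ry` here, cancel and leave a factor independent of j, p and r. -/
theorem low_factor_collect {A B C D E F G H J Q R S X ry rz f : ℂ} (hy : ry ≠ 0)
    (h : A * B * C * D * E * F = X) :
    A * (B * (C * (G * (ry / rz) * (H / f) * J) * Q) * (D * R / ry * (E * S * F)))
      = X / (rz * f) * (G * H * J * Q * S * R) := by
  have := mul_inv_cancel₀ hy
  rw [← h]
  simp only [div_eq_mul_inv, mul_inv]
  linear_combination (A * B * C * D * E * F * rz⁻¹ * f⁻¹ * (G * H * J * Q * S * R)) * this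

theorem high_factor_collect {A A' B C D E F G H J Q R S X rt rv rz f : ℂ} (hw : rt ≠ 0)
    (hv : rv ≠ 0) (h : A * A' * B * C * D * E * F = X) :
    A * A' * (B * (C * (G * (rt / rz) * (H / f) * J) * (rv / rt) * Q)
        * (D * R / rv * (E * S * F)))
      = X / (rz * f) * (G * H * J * Q * S * R) := by
  have h1 := mul_inv_cancel₀ hw
  have h2 := mul_inv_cancel₀ hv
  rw [← h]
  simp only [div_eq_mul_inv, mul_inv]
  linear_combination (A * A' * B * C * D * E * F * rz⁻¹ * f⁻¹ * (G * H * J * Q * S * R))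
    * (rv * rv⁻¹ * h1 + h2)

theorem low_sign_collect {l m j p : ℤ} {a N M r : ℕ}
    (hM : (M : ℤ) = N + j) (hMN : M ≤ 2 * N) :
    Complex.I ^ (m - (m - j)) * (-1) ^ r * (-1) ^ (((2 * N - M : ℕ) : ℤ) - N)
      * (-1) ^ (l + a - 1 - m - p) * (-1) ^ (p + r - M) * (2 * Complex.I) ^ ((a : ℤ) - m + j - 2 * p)
      = Complex.I ^ ((a : ℤ) - m) * 2 ^ ((a : ℤ) - m) * (-1) ^ (l + a - 1 + N + m)
        * ((-1) ^ (j + p) * 2 ^ (j - 2 * p)) := by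
    rw [mul_zpow, show (a : ℤ) - m + j - 2 * p = (a - m) + (j - 2 * p) by ring,
      zpow_add₀ (two_ne_zero), ← zpow_natCast]
    simp only [neg_one_zpow_eq_I_zpow]
    have h : Complex.I ^ (m - (m - j)) * Complex.I ^ (2 * (r : ℤ))
        * Complex.I ^ (2 * (((2 * N - M : ℕ) : ℤ) - N))
        * Complex.I ^ (2 * (l + a - 1 - m - p)) * Complex.I ^ (2 * (p + r - M))
        * Complex.I ^ ((a : ℤ) - m + (j - 2 * p))
        = Complex.I ^ ((a : ℤ) - m) * Complex.I ^ (2 * (l + a - 1 + N + m))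
          * Complex.I ^ (2 * (j + p)) := by
      simp only [← zpow_add₀ Complex.I_ne_zero]
      exact I_zpow_congr (by omega)
    linear_combination (2 ^ ((a : ℤ) - m) * 2 ^ (j - 2 * p)) * h

theorem high_sign_collect {l m j p : ℤ} {a N s r : ℕ} (hs : (s : ℤ) = N + (l + a - 1)) :
    Complex.I ^ (m - j - m) * (-1) ^ (l + a - 1) * (-1) ^ r * (-1) ^ (l + a - 1)
      * (-1) ^ (j - m - p) * (-1) ^ (p + r - s) * (2 * Complex.I) ^ ((a : ℤ) - m + j - 2 * p)
      = Complex.I ^ ((a : ℤ) - m) * 2 ^ ((a : ℤ) - m) * (-1) ^ (l + a - 1 + N + m)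
        * ((-1) ^ (j + p) * 2 ^ (j - 2 * p)) := by
    rw [mul_zpow, show (a : ℤ) - m + j - 2 * p = (a - m) + (j - 2 * p) by ring,
      zpow_add₀ (two_ne_zero), ← zpow_natCast]
    simp only [neg_one_zpow_eq_I_zpow]
    have h : Complex.I ^ (m - j - m) * Complex.I ^ (2 * (l + a - 1)) * Complex.I ^ (2 * (r : ℤ))
        * Complex.I ^ (2 * (l + a - 1))
        * Complex.I ^ (2 * (j - m - p)) * Complex.I ^ (2 * (p + r - s))
        * Complex.I ^ ((a : ℤ) - m + (j - 2 * p))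
        = Complex.I ^ ((a : ℤ) - m) * Complex.I ^ (2 * (l + a - 1 + N + m))
          * Complex.I ^ (2 * (j + p)) := by
      simp only [← zpow_add₀ Complex.I_ne_zero]
      exact I_zpow_congr (by omega)
    linear_combination (2 ^ ((a : ℤ) - m) * 2 ^ (j - 2 * p)) * h

theorem topCoeff_explicitSolution_of_nonpos {l m j p : ℤ} {a N α s M : ℕ}
    (hα : (α : ℤ) = N + m) (hs : (s : ℤ) = N + (l + a - 1)) (hM : (M : ℤ) = N + j)
    (hm : (N : ℤ) < m) (hsN : s ≤ 2 * N) (hj : j ≤ 0)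
    (hp0 : 0 ≤ p) (hp : 2 * p ≤ a - m + j) :
    topCoeff a m (explicitSolution l a N m) j p = explicitFactor l a N m
      * ((-1) ^ (j + p) * 2 ^ (j - 2 * p)
        * (sumLower (2 * N) α (2 * N - s) M p * finv (α + p - s))) := by
  -- The degree is nonnegative and j ≤ 0, so a ≥ m; with s ≤ 2N this places the Gamma denominators
  -- at poles.
  have hz : l + ((a : ℤ) - m - 1) / 2 ≤ 0 := by omega
  have hy : l + ((a : ℤ) - m - j - 1) / 2 ≤ 0 := by omega
  unfold topCoeff explicitSolution
  rw [if_neg (by omega), if_pos (by omega), wcoeff_C_mul, wcoeff_sum,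
    show ((N : ℤ) + m - (m - j)).toNat = M by omega,
    show ((N : ℤ) - m + (m - j)).toNat = 2 * N - M by omega, sumLower, Finset.sum_mul,
    Finset.mul_sum, Finset.mul_sum, Finset.mul_sum]
  refine Finset.sum_congr rfl fun r hr => ?_
  have hr' := Finset.mem_range.1 hr
  have hG := constG_eq (l := l) (a := a) (d := M) (r := r) hα (by omega) (by omega) hz
  rw [show (a : ℤ) - m + N - M - 1 = a - m - j - 1 by omega] at hG
  rw [wcoeff_C_mul, show ((l : ℂ) + N - 1 - r) = ((l + N - 1 - r : ℤ) : ℂ) by push_cast; ring,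
    wcoeff_gegenbauerI _ _ _ (p + r - M) (by omega) (by omega),
    show l + N - 1 - r + ((a : ℤ) + (m - j) - 2 * (m + N - r)) - (p + r - M)
      = l + a - 1 - m - p by omega,
    show l + N - 1 - r + ((a : ℤ) + (m - j) - 2 * (m + N - r) + 1) / 2
      = l + ((a : ℤ) - m - j - 1) / 2 by omega, gammaQuot_of_nonpos_right hy, constB,
    show 2 * N - (2 * N - M) = M by omega, hG,
    show (N : ℤ) - (l + a) + 2 = (2 * N - s : ℕ) + 1 by omega, gammaQuot_descFactorial]
  have hy' := gammaResidue_ne_zero hy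
  rw [explicitFactor, show gammaResidue (l + a - 1 - m - p)
    = (-1) ^ (l + a - 1 - m - p) * finv (α + p - s) by
      unfold gammaResidue; congr 2; omega]
  have hI := low_sign_collect (l := l) (m := m) (p := p) (r := r) (a := a) hM (by omega : M ≤ 2 * N)
  generalize gammaResidue (l + ((a : ℤ) - m - j - 1) / 2) = ry at *
  generalize gammaResidue (l + ((a : ℤ) - m - 1) / 2) = rz at *
  rw [low_factor_collect hy' hI]
  ring

theorem topCoeff_explicitSolution_of_pos {l m j p : ℤ} {a N α s M : ℕ}
    (hα : (α : ℤ) = N + m) (hs : (s : ℤ) = N + (l + a - 1)) (hM : (M : ℤ) = N + j)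
    (hm : (N : ℤ) < m) (hsN : s ≤ 2 * N) (hsa : l + a - 1 ≤ a - m) (hj : 0 < j) (hjN : j ≤ N)
    (hp : 2 * p ≤ a - m + j) :
    topCoeff a m (explicitSolution l a N m) j p = explicitFactor l a N m
      * ((-1) ^ (j + p) * 2 ^ (j - 2 * p)
        * (sumUpper (2 * N) α s (2 * N - M) p * finv (α + p - M))) := by
  -- For j > 0 the degree no longer forces a ≥ m; the bound `hsa`, that is l ≤ 1 - m, does that
  -- work.
  have hz : l + ((a : ℤ) - m - 1) / 2 ≤ 0 := by omega
  have hw : l + ((a : ℤ) - m + j - 1) / 2 ≤ 0 := by omega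
  have hv : l + (-(l + a) - l - m + j + 1) / 2 ≤ 0 := by omega
  unfold topCoeff explicitSolution
  rw [if_pos (by omega), wcoeff_C_mul, wcoeff_sum,
    show ((N : ℤ) - m + (m - j)).toNat = 2 * N - M by omega, sumUpper, Finset.sum_mul,
    Finset.mul_sum, Finset.mul_sum, Finset.mul_sum]
  refine Finset.sum_congr rfl fun r hr => ?_
  have hr' := Finset.mem_range.1 hr
  have hG := constG_eq (l := l) (a := a) (d := 2 * N - M) (r := r) hα (by omega) (by omega) hz
  rw [show (a : ℤ) - m + N - (2 * N - M : ℕ) - 1 = a - m + j - 1 by omega] at hG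
  rw [wcoeff_C_mul, show ((l : ℂ) + N - 1 - r) = ((l + N - 1 - r : ℤ) : ℂ) by push_cast; ring,
    wcoeff_gegenbauerI _ _ _ (p + r - s) (by omega) (by omega),
    show l + N - 1 - r + ((a : ℤ) - (m - j) + 2 * (1 - N - (l + a) + r)) - (p + r - s)
      = j - m - p by omega,
    show l + N - 1 - r + ((a : ℤ) - (m - j) + 2 * (1 - N - (l + a) + r) + 1) / 2
      = l + (-(l + a) - l - m + j + 1) / 2 by omega, gammaQuot_of_nonpos_right hv, constA, hG,
    abs_of_nonneg (show 0 ≤ m by omega),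
    show -(l + (a : ℤ)) - l - m + N - (2 * N - M : ℕ) + 1 = -(l + a) - l - m + j + 1 by omega,
    show l + (a : ℤ) - l - m + N - (2 * N - M : ℕ) - 1 = a - m + j - 1 by omega,
    gammaQuot_of_nonpos_right hw,
    show (N : ℤ) + (l + a) = s + 1 by omega, gammaQuot_descFactorial]
  have hw' := gammaResidue_ne_zero hw
  have hv' := gammaResidue_ne_zero hv
  rw [explicitFactor, show gammaResidue (j - m - p)
    = (-1) ^ (j - m - p) * finv (α + p - M) by
      unfold gammaResidue; congr 2; omega]
  have hI := high_sign_collect (j := j) (p := p) (m := m) (r := r) hs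
  generalize gammaResidue (l + ((a : ℤ) - m + j - 1) / 2) = rt at *
  generalize gammaResidue (l + (-(l + (a : ℤ)) - l - m + j + 1) / 2) = rv at *
  generalize gammaResidue (l + ((a : ℤ) - m - 1) / 2) = rz at *
  rw [high_factor_collect hw' hv' hI]
  ring

/-- The weighted coefficients of the explicit solution, up to a common factor. -/
def solCoeff (N α s : ℕ) (j p : ℤ) : ℂ :=
  (-1) ^ (j + p) * 2 ^ (j - 2 * p)
    * (sumLowerInt (2 * N) α (2 * N - s) (N + j) p * finv (α + p - s))

theorem topCoeff_explicitSolution {l m j p : ℤ} {a N α s : ℕ}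
    (hα : (α : ℤ) = N + m) (hs : (s : ℤ) = N + (l + a - 1)) (hm : (N : ℤ) < m) (hsN : s ≤ 2 * N)
    (hsa : l + a - 1 ≤ a - m) (hj : -(N : ℤ) ≤ j) (hjN : j ≤ N)
    (hp0 : 0 ≤ p) (hp : 2 * p ≤ a - m + j) :
    topCoeff a m (explicitSolution l a N m) j p
      = explicitFactor l a N m * solCoeff N α s j p := by
  obtain ⟨M, hM⟩ := Int.eq_ofNat_of_zero_le (show 0 ≤ N + j by omega)
  rw [solCoeff, hM, sumLowerInt_natCast]
  rcases le_or_gt j 0 with h | h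
  · exact topCoeff_explicitSolution_of_nonpos hα hs hM.symm hm hsN h hp0 hp
  · rw [topCoeff_explicitSolution_of_pos hα hs hM.symm hm hsN hsa h hjN hp,
      sumLower_mul_finv_eq _ _ _ _ hsN (by omega)]

theorem explicitSolution_of_not_range {l m k : ℤ} {a N : ℕ}
    (hk : ¬ (m - N ≤ k ∧ k ≤ m + N)) : explicitSolution l a N m k = 0 := by
  unfold explicitSolution
  rw [if_neg (by omega), if_neg (by omega)]

theorem explicitSolution_mem_polEven {l m k : ℤ} {a N s : ℕ}
    (hs : (s : ℤ) = N + (l + a - 1)) (hk : k ≤ m + N) :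
    explicitSolution l a N m k ∈ polEven (a - k) := by
  unfold explicitSolution
  split_ifs with h
  · rw [← smul_eq_C_mul]
    refine Submodule.smul_mem _ _ (Submodule.sum_mem _ fun r _ => ?_)
    rw [← smul_eq_C_mul]
    rcases le_or_gt r s with hr | hr
    · exact Submodule.smul_mem _ _ (gegenbauerI_mem_polEven _ (s - r) (by omega))
    -- For r > s the Gegenbauer index exceeds a - k, but A(d, r) contains the falling factorial of s
    -- of length r, which is zero.
    · rw [constA, show (N : ℤ) + (l + a) = s + 1 by omega, gammaQuot_descFactorial,
        Nat.descFactorial_of_lt hr]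
      simp
  · rw [← smul_eq_C_mul]
    refine Submodule.smul_mem _ _ (Submodule.sum_mem _ fun r hr => ?_)
    rw [← smul_eq_C_mul]
    have := Finset.mem_range.1 hr
    exact Submodule.smul_mem _ _ (gegenbauerI_mem_polEven _ (N + m - k - r).toNat (by omega))
  · exact Submodule.zero_mem _

/-! ### Recursions and nonvanishing for the explicit solution -/

theorem solCoeff_recLower {σ : ℂ} {m : ℤ} {N α s : ℕ} (hα : (α : ℤ) = N + m)
    (hσ : σ = s - N) (j p : ℤ) : RecLower σ N m (solCoeff N α s) j p := by
  have h := sumLowerInt_rec (2 * N) α (2 * N - s) (N + j) p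
  have f := mul_finv (α + p - s)
  have hm : (m : ℂ) = α - N := by
    have := congrArg (Int.cast (R := ℂ)) hα
    push_cast at this; linear_combination -this
  unfold RecLower solCoeff
  rw [show j + (p - 1) = j + p - 1 by ring, zpow_sub_one₀ (by norm_num),
    show j - 2 * (p - 1) = j - 2 * p + 1 + 1 by ring,
    show j - 1 + (p - 1) = j + p - 1 - 1 by ring, zpow_sub_one₀ (by norm_num),
    zpow_sub_one₀ (by norm_num),
    show j - 1 - 2 * (p - 1) = j - 2 * p + 1 by ring, zpow_add_one₀ (by norm_num),
    zpow_add_one₀ (by norm_num),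
    show (α : ℤ) + (p - 1) - s = α + p - s - 1 by ring, ← f, hσ, hm,
    show (N : ℤ) + (j - 1) = N + j - 1 by ring]
  push_cast at h ⊢
  rw [show (-1 : ℂ)⁻¹ = -1 by norm_num]
  linear_combination (-4 * (-1) ^ (j + p) * 2 ^ (j - 2 * p) * (α + p - s)
    * finv (α + p - s)) * h

theorem solCoeff_recThree {σ : ℂ} {m : ℤ} {N α s : ℕ} (hα : (α : ℤ) = N + m)
    (hσ : σ = s - N) (hs : s ≤ 2 * N) {j : ℤ} (hj : -(N : ℤ) ≤ j) (hjN : j ≤ N) (p : ℤ) :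
    RecThree σ N m (solCoeff N α s) j p := by
  have h := sumLowerInt_three (2 * N) α s hs p (M := N + j) (by omega) (by omega)
  have f := mul_finv (α + p - s)
  have hm : (m : ℂ) = α - N := by
    have := congrArg (Int.cast (R := ℂ)) hα
    push_cast at this; linear_combination -this
  unfold RecThree solCoeff
  rw [show j + 1 + p = j + p + 1 by ring, zpow_add_one₀ (by norm_num),
    show j + 1 - 2 * p = j - 2 * p + 1 by ring,
    show j - 1 + (p - 1) = j + p - 1 - 1 by ring, zpow_sub_one₀ (by norm_num),
    zpow_sub_one₀ (by norm_num),
    show j - 1 - 2 * (p - 1) = j - 2 * p + 1 by ring, zpow_add_one₀ (by norm_num),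
    show (α : ℤ) + (p - 1) - s = α + p - s - 1 by ring, ← f, hσ, hm,
    show (N : ℤ) + (j - 1) = N + j - 1 by ring, show (N : ℤ) + (j + 1) = N + j + 1 by ring]
  push_cast at h ⊢
  rw [show (-1 : ℂ)⁻¹ = -1 by norm_num]
  linear_combination (2 * (-1) ^ (j + p) * 2 ^ (j - 2 * p) * finv (α + p - s)) * h

theorem explicitSolution_mem {l m : ℤ} {a N s : ℕ} (hs : (s : ℤ) = N + (l + a - 1))
    (hm : (N : ℤ) < m) (hsN : s ≤ 2 * N) (hsa : l + a - 1 ≤ a - m) :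
    explicitSolution l a N m ∈ solutionSpace l a N m := by
  obtain ⟨α, hα⟩ := Int.eq_ofNat_of_zero_le (show 0 ≤ N + m by omega)
  have h1 : ∀ k : ℤ, m - N ≤ k → k ≤ m + N → explicitSolution l a N m k ∈ polEven (a - k) :=
    fun k _ hk => explicitSolution_mem_polEven hs hk
  have h2 : ∀ k : ℤ, ¬ (m - N ≤ k ∧ k ≤ m + N) → explicitSolution l a N m k = 0 :=
    fun k hk => explicitSolution_of_not_range hk
  have hσ : (l : ℂ) + a - 1 = s - N := by
    have := congrArg (Int.cast (R := ℂ)) hs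
    push_cast at this; linear_combination -this
  have hc : ∀ j p : ℤ, -(N : ℤ) ≤ j → j ≤ N → 2 * p ≤ a - m + j →
      topCoeff a m (explicitSolution l a N m) j p
        = explicitFactor l a N m * solCoeff N α s j p := by
    intro j p hj hj' hp
    rcases lt_or_ge p 0 with hp0 | hp0
    · rw [topCoeff_eq_zero h1 h2 j hp0, solCoeff, sumLowerInt_of_neg_right _ _ _ _ hp0]
      simp
    · exact topCoeff_explicitSolution hα.symm hs hm hsN hsa hj hj' hp0 hp
  refine mem_of_rec h1 h2 fun j p hj hj' hp => ?_
  -- The closed form is known only for |j| ≤ N; the boundary factors N + j and N - j hide the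
  -- neighbours outside.
  have hlow : ((N : ℂ) + j) * topCoeff a m (explicitSolution l a N m) (j - 1) (p - 1)
      = (N + j) * (explicitFactor l a N m * solCoeff N α s (j - 1) (p - 1)) := by
    rcases eq_or_lt_of_le hj with rfl | hlt
    · simp
    · rw [hc _ _ (by omega) (by omega) (by omega)]
  have hup : ((N : ℂ) - j) * topCoeff a m (explicitSolution l a N m) (j + 1) p
      = (N - j) * (explicitFactor l a N m * solCoeff N α s (j + 1) p) := by
    rcases eq_or_lt_of_le hj' with rfl | hlt
    · simp
    · rw [hc _ _ (by omega) (by omega) (by omega)]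
  have r1 := solCoeff_recLower hα.symm hσ j p
  have r2 := solCoeff_recThree hα.symm hσ hsN hj hj' p
  unfold RecLower RecThree at *
  rw [mul_assoc 2, hlow, hup, hc j p hj hj' hp, hc j (p - 1) hj hj' (by omega)]
  exact ⟨by linear_combination explicitFactor l a N m * r1,
    by linear_combination explicitFactor l a N m * r2⟩

/-- At p = 0 only the term r = M = 2N - s survives. It is nonzero because the falling factorial of
2N - s is taken to its full length and α = N + m > 2N. -/
theorem topCoeff_explicitSolution_ne_zero {l m : ℤ} {a N s : ℕ} (hs : (s : ℤ) = N + (l + a - 1))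
    (hm : (N : ℤ) < m) (hsN : s ≤ 2 * N) (hsa : l + a - 1 ≤ a - m) :
    topCoeff a m (explicitSolution l a N m) (-(l + a - 1)) 0 ≠ 0 := by
  obtain ⟨α, hα⟩ := Int.eq_ofNat_of_zero_le (show 0 ≤ N + m by omega)
  rw [topCoeff_explicitSolution hα.symm hs hm hsN hsa (by omega) (by omega) le_rfl (by omega),
    solCoeff, show (N : ℤ) + -(l + a - 1) = (2 * N - s : ℕ) by omega, sumLowerInt_natCast,
    sumLower_zero_right, explicitFactor]
  have hz := gammaResidue_ne_zero (show l + ((a : ℤ) - m - 1) / 2 ≤ 0 by omega)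
  have d1 : α.descFactorial (2 * N - s) ≠ 0 := by
    rw [Ne, Nat.descFactorial_eq_zero_iff_lt]; omega
  have d2 : (2 * N - s).descFactorial (2 * N - s) ≠ 0 := by
    rw [Ne, Nat.descFactorial_eq_zero_iff_lt]; omega
  have hf := finv_ne_zero (show 0 ≤ (α : ℤ) + 0 - s by omega)
  have hn : (-1 : ℂ) ≠ 0 := by norm_num
  refine mul_ne_zero (div_ne_zero (mul_ne_zero (mul_ne_zero ?_ ?_) ?_) (mul_ne_zero hz ?_))
    (mul_ne_zero (mul_ne_zero ?_ ?_) (mul_ne_zero (mul_ne_zero (mul_ne_zero ?_ ?_) ?_) hf))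
  · exact zpow_ne_zero _ Complex.I_ne_zero
  · exact zpow_ne_zero _ two_ne_zero
  · exact zpow_ne_zero _ hn
  · exact Nat.cast_ne_zero.2 (Nat.factorial_ne_zero _)
  · exact zpow_ne_zero _ hn
  · exact zpow_ne_zero _ two_ne_zero
  · exact Nat.cast_ne_zero.2 (Nat.factorial_ne_zero _)
  · exact Nat.cast_ne_zero.2 d1
  · exact Nat.cast_ne_zero.2 d2

/-! ### The set Λ(N, a) and the spanning statement -/

theorem exists_of_mem_Lambda {l m : ℤ} {a N : ℕ} (hl : l ∈ Lambda a N m) :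
    ∃ s : ℕ, (s : ℤ) = N + (l + a - 1) ∧ s ≤ 2 * N ∧ l + a - 1 ≤ a - m := by
  obtain ⟨q, h1, h2, rfl⟩ := hl
  have h3 := (le_max_left _ _).trans h1
  have h4 := (le_max_right _ _).trans h1
  -- Here σ = N - q, so s = 2N - q, and q ≥ N - a + m says that the degree a - m - σ at p = 0 is
  -- nonnegative.
  exact ⟨(2 * N - q).toNat, by omega, by omega, by omega⟩

theorem solutionSpace_eq_span {l m : ℤ} {a N : ℕ} (hm : (N : ℤ) < m) (hl : l ∈ Lambda a N m) :
    solutionSpace l a N m = Submodule.span ℂ {explicitSolution l a N m} := by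
  obtain ⟨s, hs, hsN, hsa⟩ := exists_of_mem_Lambda hl
  have hmem := explicitSolution_mem hs hm hsN hsa
  have hne := topCoeff_explicitSolution_ne_zero hs hm hsN hsa
  refine le_antisymm (fun g hg => ?_)
    (Submodule.span_le.2 (Set.singleton_subset_iff.2 hmem))
  rw [Submodule.mem_span_singleton]
  -- Subtracting this multiple cancels the coefficient at (-σ, 0), which determines a solution.
  refine ⟨topCoeff a m g (-(l + a - 1)) 0
    / topCoeff a m (explicitSolution l a N m) (-(l + a - 1)) 0, ?_⟩
  refine (sub_eq_zero.1 (eq_zero_of_topCoeff hm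
    (Submodule.sub_mem _ hg (Submodule.smul_mem _ _ hmem)) fun j _ _ _ hj => ?_)).symm
  obtain rfl : j = -(l + a - 1) := by
    have : ((l + a - 1 + j : ℤ) : ℂ) = 0 := by push_cast; exact hj
    have := Int.cast_eq_zero.1 this
    omega
  unfold topCoeff at hne ⊢
  rw [Pi.sub_apply, Pi.smul_apply, wcoeff_sub, smul_eq_C_mul, wcoeff_C_mul, div_mul_cancel₀ _ hne,
    sub_self]

theorem solutionSpace_eq_bot {lam : ℂ} {m : ℤ} {a N : ℕ} (hm : (N : ℤ) < m)
    (h : ¬ ∃ l ∈ Lambda a N m, lam = (l : ℂ)) : solutionSpace lam a N m = ⊥ := by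
  rw [eq_bot_iff]
  intro g hg
  refine (Submodule.mem_bot ℂ).2 (eq_zero_of_topCoeff hm hg fun j hj hj' hd hs => ?_)
  -- An index j = -σ with nonnegative degree gives the element of Λ(N, a) with q = N + j.
  refine absurd ⟨1 - a - j, ⟨N + j, max_le (by omega) (by omega), by omega, by ring⟩, ?_⟩ h
  push_cast
  linear_combination hs

end GegenbauerSystem

end

theorem mainTheorem6 (lam : ℂ) (a N : ℕ) (m : ℤ) (hm : (N : ℤ) < m) :
    [GegenbauerSystem.solutionSpace lam a N m ≠ ⊥,
      Module.finrank ℂ (GegenbauerSystem.solutionSpace lam a N m) = 1,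
      ∃ l ∈ GegenbauerSystem.Lambda a N m, lam = (l : ℂ)].TFAE ∧
    ∀ l ∈ GegenbauerSystem.Lambda a N m, lam = (l : ℂ) →
      GegenbauerSystem.solutionSpace lam a N m =
        Submodule.span ℂ {GegenbauerSystem.explicitSolution l a N m} := by
  refine ⟨?_, fun l hl h => h ▸ GegenbauerSystem.solutionSpace_eq_span hm hl⟩
  tfae_have 1 → 3 := fun h => by
    by_contra h3
    exact h (GegenbauerSystem.solutionSpace_eq_bot hm h3)
  tfae_have 3 → 2 := by
    rintro ⟨l, hl, rfl⟩
    obtain ⟨s, hs, hsN, hsa⟩ := GegenbauerSystem.exists_of_mem_Lambda hl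
    rw [GegenbauerSystem.solutionSpace_eq_span hm hl]
    refine finrank_span_singleton fun h => ?_
    refine GegenbauerSystem.topCoeff_explicitSolution_ne_zero hs hm hsN hsa ?_
    rw [h]
    exact GegenbauerSystem.wcoeff_zero _
  tfae_have 2 → 1 := fun h h' => by
    rw [h', finrank_bot] at h
    exact zero_ne_one h
  tfae_finish
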